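/- Let $N\ge 2$, let $\Omega\subset\mathbb R^N$ be open and bounded, and let $a_{ij}=a_{ji},\alpha_j,\beta$ ($1\le i,j\le N$) be real-valued bounded measurable coefficients on $\Omega$ (for instance smooth up to the boundary) such that, for some $\eta>0$, $$\sum_{i,j=1}^N a_{ij}(x)\sigma_i\sigma_j\ge \eta|\sigma|^2\qquad(x\in\Omega,\ \sigma\in\mathbb R^N).$$ Let $c:\Omega\to\mathbb R^N$ belong to $L^{N,\infty}(\Omega)$, i.e. $c$ is measurable and $\|c\|_{N,\infty}<\infty$, where $$\|g\|_{N,\infty}^N=\sup_{h>0}h^N\,\big|\{x\in\Omega:|g(x)|>h\}\big| .$$ Let $K>0$, $T_K(s)=\frac{s}{|s|}\min\{|s|,K\}$ with $T_K(0)=0$, and let $\theta(x)=T_K(c(x))/c(x)$, that is, $\theta(x)=\min\{|c(x)|,K\}/|c(x)|$ if $c(x)\neq0$ and $\theta(x)=1$ if $c(x)=0$, so that $T_Kc=\theta c$. Functions in $H^1(\Omega)$ are complex valued, $H^1_0(\Omega)$ is the closure of $C_c^\infty(\Omega)$ in $H^1(\Omega)$, and $\|u\|_{H^1}^2=\|u\|_{L^2}^2+\|\nabla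 u\|_{L^2}^2$. A form $q$ on a subspace $V$ of $H^1(\Omega)$ is called $L^2(\Omega)$-elliptic if there are $\omega\in\mathbb R$ and $\kappa>0$ with $$\operatorname{Re} q(u,u)+\omega\|u\|_{L^2(\Omega)}^2\ge \kappa\|u\|_{H^1(\Omega)}^2\qquad(u\in V).$$ For a vector field $b$ on $\Omega$ put $$\hat a_b(u,v)=\int_\Omega\Big(\sum_{i,j=1}^N a_{ij}\,\partial_iu\,\partial_j\bar v+\sum_{j=1}^N\big(\alpha_j\,\partial_ju\,\bar v+b_j\,u\,\partial_j\bar v\big)+\beta u\bar v\Big)dx .$$ Then: (a) for $b_j=1-\theta$ ($1\le j\le N$), the integral defining $\hat a_b$ converges absolutely on $H^1(\Omega)\times H^1(\Omega)$, and $\hat a_b$ is $L^2(\Omega)$-elliptic on $H^1(\Omega)$; (b) for $b=(1-\theta)c=c-T_Kc$, if $$\|c-T_Kc\|_{N,\infty}\le \frac{\eta}{2S_{N,2}},\qquad S_{N,2}=\omega_N^{-1/N}\,\frac{2}{N-2},$$ where $\omega_N$ is the volume of the unit ball of $\mathbb R^N$ (for $N=2$ one reads $S_{2,2}=\infty$,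 so that the condition is $c=T_Kc$ a.e.), then the integral defining $\hat a_b$ converges absolutely on $H^1_0(\Omega)\times H^1_0(\Omega)$, and $\hat a_b$ is $L^2(\Omega)$-elliptic on $H^1_0(\Omega)$. -/

import Mathlib

open MeasureTheory Filter Topology
open scoped ENNReal NNReal ComplexConjugate

noncomputable section

namespace ConvDiff

/-- `ℝ^N` with the Euclidean norm. -/
abbrev Space (N : ℕ) : Type := EuclideanSpace ℝ (Fin N)

/-! ### The weak Lebesgue (Marcinkiewicz) quasi-norm and the Sobolev constant -/

/-- The distribution function `λ_g(h) = |{x ∈ Ω : |g(x)| > h}|`. -/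
def distrib {N : ℕ} {F : Type*} [Norm F] (Ω : Set (Space N)) (g : Space N → F) (h : ℝ≥0) :
    ℝ≥0∞ :=
  volume {x ∈ Ω | (h : ℝ) < ‖g x‖}

/-- `‖g‖_{p,∞}`, where `‖g‖_{p,∞}^p = sup_{h > 0} h^p λ_g(h)`; the value lies in `[0,∞]`. -/
def weakNorm {N : ℕ} {F : Type*} [Norm F] (Ω : Set (Space N)) (p : ℝ) (g : Space N → F) :
    ℝ≥0∞ :=
  (⨆ (h : ℝ≥0) (_ : 0 < h), (h : ℝ≥0∞) ^ p * distrib Ω g h) ^ (1 / p)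

/-- `g` belongs to `L^{p,∞}(Ω)`. -/
def MemWeakLp {N : ℕ} (Ω : Set (Space N)) (p : ℝ) (g : Space N → Space N) : Prop :=
  AEStronglyMeasurable g (volume.restrict Ω) ∧ weakNorm Ω p g < ∞

/-- `S_{N,p} = ω_N^{-1/N} p / (N - p)`, with `ω_N` the volume of the unit ball of `ℝ^N`.
The value lies in `[0,∞]`, and it is `∞` when `p = N`. -/
def sobolevConst (N : ℕ) (p : ℝ≥0∞) : ℝ≥0∞ :=
  volume (Metric.ball (0 : Space N) 1) ^ (-(1 / (N : ℝ))) * (p / ((N : ℝ≥0∞) - p))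

/-! ### Truncation -/

/-- The truncation `T_K(s) = (s / |s|) min(|s|, K)`, on scalars and on vectors. -/
def trunc {F : Type*} [NormedAddCommGroup F] [NormedSpace ℝ F] (K : ℝ) (s : F) : F :=
  (min ‖s‖ K / ‖s‖) • s

/-- The coefficient `θ = T_K(s) / s`, i.e. the scalar with `T_K(s) = θ s`; it is `1` at `s = 0`. -/
def theta {F : Type*} [NormedAddCommGroup F] (K : ℝ) (s : F) : ℝ :=
  open Classical in if s = 0 then 1 else min ‖s‖ K / ‖s‖

theorem trunc_eq_theta_smul {F : Type*} [NormedAddCommGroup F] [NormedSpace ℝ F] (K : ℝ) (s : F) :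
    trunc K s = theta K s • s := by
  by_cases h : s = 0 <;> simp [trunc, theta, h]

/-! ### The spaces `H¹(Ω)` and `H¹₀(Ω)` of complex-valued functions -/

/-- The `i`-th partial derivative of a differentiable function. -/
def partialD {N : ℕ} (i : Fin N) (φ : Space N → ℂ) (x : Space N) : ℂ :=
  fderiv ℝ φ x (EuclideanSpace.single i 1)

/-- `φ ∈ C_c^∞(Ω)`. -/
structure IsTestFunction {N : ℕ} (Ω : Set (Space N)) (φ : Space N → ℂ) : Prop where
  smooth : ContDiff ℝ ((⊤ : ℕ∞) : WithTop ℕ∞) φ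
  compact : HasCompactSupport φ
  supp : tsupport φ ⊆ Ω

/-- Elements of `H¹(Ω)`: a function in `L²(Ω)` together with its weak gradient in `L²(Ω)`. -/
structure H1 {N : ℕ} (Ω : Set (Space N)) where
  val : Lp ℂ 2 (volume.restrict Ω)
  grad : Fin N → Lp ℂ 2 (volume.restrict Ω)
  weak : ∀ (i : Fin N) (φ : Space N → ℂ), IsTestFunction Ω φ →
    ∫ x in Ω, val x * partialD i φ x = -∫ x in Ω, grad i x * φ x

/-- `‖u‖²_{H¹(Ω)} = ‖u‖²_{L²(Ω)} + ‖∇u‖²_{L²(Ω)}`. -/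
def H1.normSq {N : ℕ} {Ω : Set (Space N)} (u : H1 Ω) : ℝ :=
  ‖u.val‖ ^ 2 + ∑ i, ‖u.grad i‖ ^ 2

/-- `H¹₀(Ω)`: the closure of `C_c^∞(Ω)` in `H¹(Ω)`. -/
def H10 {N : ℕ} (Ω : Set (Space N)) : Set (H1 Ω) :=
  {u | ∃ φ : ℕ → Space N → ℂ, (∀ n, IsTestFunction Ω (φ n)) ∧
    Tendsto (fun n => eLpNorm (fun x => φ n x - u.val x) 2 (volume.restrict Ω)) atTop (𝓝 0) ∧
    ∀ i, Tendsto (fun n => eLpNorm (fun x => partialD i (φ n) x - u.grad i x) 2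
      (volume.restrict Ω)) atTop (𝓝 0)}

/-! ### The sesquilinear form -/

/-- The coefficients `a_{ij}, α_j, β` of the operator
`D u = -∑ ∂_i (a_{ij} ∂_j u) + ∑ α_j ∂_j u + β u`. -/
structure Coeffs (N : ℕ) where
  a : Space N → Matrix (Fin N) (Fin N) ℝ
  α : Space N → Fin N → ℝ
  β : Space N → ℝ

/-- Bounded measurable coefficients on `Ω`, symmetric and strongly elliptic with constant `η`. -/
structure Coeffs.IsStronglyElliptic {N : ℕ} (D : Coeffs N) (Ω : Set (Space N)) (η : ℝ) :
    Prop where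
  bdd_a : ∀ i j, MemLp (fun x => D.a x i j) ∞ (volume.restrict Ω)
  bdd_α : ∀ j, MemLp (fun x => D.α x j) ∞ (volume.restrict Ω)
  bdd_β : MemLp D.β ∞ (volume.restrict Ω)
  symm : ∀ x ∈ Ω, ∀ i j, D.a x i j = D.a x j i
  pos : 0 < η
  elliptic : ∀ x ∈ Ω, ∀ σ : Space N, η * ‖σ‖ ^ 2 ≤ ∑ i, ∑ j, D.a x i j * σ i * σ j

/-- The integrand
`∑_{i,j} a_{ij} ∂_i u ∂_j v̄ + ∑_j (α_j ∂_j u v̄ + b_j u ∂_j v̄) + β u v̄`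
for a real vector field `b`. -/
def formIntegrand {N : ℕ} {Ω : Set (Space N)} (D : Coeffs N) (b : Space N → Fin N → ℝ)
    (u v : H1 Ω) (x : Space N) : ℂ :=
  (∑ i, ∑ j, (D.a x i j : ℂ) * u.grad i x * conj (v.grad j x))
    + (∑ j, ((D.α x j : ℂ) * u.grad j x * conj (v.val x)
        + (b x j : ℂ) * u.val x * conj (v.grad j x)))
    + (D.β x : ℂ) * u.val x * conj (v.val x)

/-- The form with first-order divergence part given by the vector field `b`. -/
def form {N : ℕ} {Ω : Set (Space N)} (D : Coeffs N) (b : Space N → Fin N → ℝ)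
    (u v : H1 Ω) : ℂ :=
  ∫ x in Ω, formIntegrand D b u v x

/-- The form is given by an absolutely convergent integral on `V × V`. -/
def IsWellDefinedOn {N : ℕ} {Ω : Set (Space N)} (D : Coeffs N) (b : Space N → Fin N → ℝ)
    (V : Set (H1 Ω)) : Prop :=
  ∀ u ∈ V, ∀ v ∈ V, IntegrableOn (formIntegrand D b u v) Ω

/-- A form on `V ⊆ H¹(Ω)` is `L²(Ω)`-elliptic: there are `ω ∈ ℝ` and `κ > 0` with
`Re q(u,u) + ω ‖u‖²_{L²} ≥ κ ‖u‖²_{H¹}` for all `u ∈ V`. -/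
def IsL2Elliptic {N : ℕ} {Ω : Set (Space N)} (V : Set (H1 Ω)) (q : H1 Ω → H1 Ω → ℂ) : Prop :=
  ∃ ω κ : ℝ, 0 < κ ∧ ∀ u ∈ V, κ * u.normSq ≤ (q u u).re + ω * ‖u.val‖ ^ 2

/-- The field all of whose components are `1 - θ`, where `θ = T_K(c) / c`. -/
def weightField {N : ℕ} (K : ℝ) (c : Space N → Space N) (x : Space N) (_j : Fin N) : ℝ :=
  1 - theta K (c x)

/-- The convective field `c` weighted by `1 - θ`, that is `c - T_K c`. -/
def weightedConvection {N : ℕ} (K : ℝ) (c : Space N → Space N) (x : Space N) (j : Fin N) : ℝ :=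
  (1 - theta K (c x)) * c x j

end ConvDiff

end

namespace ConvDiff

open Set Pointwise

/-! ### The Brunn–Minkowski and Prékopa–Leindler inequalities -/

/-! By Young's inequality the terms with `α` and `b` each cost `η/4 |∇u|²`, so ellipticity follows
once `∫ |b|²|u|² ≤ (η²/4) ‖∇u‖² + M ‖u‖²` on the form domain (`wellDefined_and_elliptic_of_bound`).
In (a) the field is bounded and `M = N` works. In (b) with `N ≥ 3` the bound, with `M = 0`, is the
inequality `‖g u‖₂ ≤ S_{N,2} ‖g‖_{N,∞} ‖∇u‖₂`: the threshold `η / (2 S_{N,2})` turns its squared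
constant into `η²/4`. Test functions come first (`hardy_lorentz`), then `H¹₀(Ω)` by Fatou. For `N =
2` the threshold is `0` and the field vanishes a.e.

The constant `S_{N,2}` is reached without symmetrization. Put `X = ∫ s |{|u| > s}|^{(N-2)/N} ds`.
Layer cake gives `∫ g²|u|² ≤ 2N/(N-2) w² X` for every `g` of weak norm at most `w`
(`lintegral_sq_mul_sq_le_of_weak`). To bound `X`, take `ψ(s) = |{|u| ≥ s}|^{-1/N}`. The
isoperimetric inequality with weight `s ψ(s)`, followed by Cauchy–Schwarz, gives `N ω_N^{1/N} X ≤
‖ψ(|u|) u‖₂ ‖Du‖₂`. Since `ψ(|u|)` has weak norm at most `1`, the first factor is again controlled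
by `X`, and one power of `X` cancels (`lintegral_superlevel_le`).

The isoperimetric inequality is the limit `ε → 0` of Brunn–Minkowski applied to `ε`-thickenings of
superlevel sets; Brunn–Minkowski itself is derived from Prékopa–Leindler. -/

/-- The one-dimensional Brunn–Minkowski inequality for compact sets. -/
theorem volume_add_volume_le_of_isCompact {K L C : Set ℝ} (hK : IsCompact K) (hL : IsCompact L)
    (hKn : K.Nonempty) (hLn : L.Nonempty) (h : K + L ⊆ C) :
    volume K + volume L ≤ volume C := by
  -- The translates `K + min L` and `max K + L` both lie in `K + L` and share only the point `max K
  -- + min L`.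
  set k := sSup K
  set l := sInf L
  have hk : k ∈ K := hK.sSup_mem hKn
  have hl : l ∈ L := hL.sInf_mem hLn
  have h1 : volume ((fun x => x + l) '' K) = volume K := by simp
  have h2 : volume ((fun x => k + x) '' L) = volume L := by simp
  have hd : AEDisjoint volume ((fun x => x + l) '' K) ((fun x => k + x) '' L) := by
    refine measure_mono_null (t := {k + l}) ?_ (by simp)
    rintro z ⟨⟨x, hx, rfl⟩, ⟨y, hy, hxy⟩⟩
    have hx' : x ≤ k := le_csSup hK.bddAbove hx
    have hy' : l ≤ y := csInf_le hL.bddBelow hy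
    simp only [mem_singleton_iff] at *
    linarith
  rw [← h1, ← h2, ← measure_union₀ _ hd]
  · refine measure_mono (union_subset ?_ ?_)
    · rintro _ ⟨x, hx, rfl⟩; exact h (add_mem_add hx hl)
    · rintro _ ⟨x, hx, rfl⟩; exact h (add_mem_add hk hx)
  · exact (hL.image (by fun_prop)).measurableSet.nullMeasurableSet

/-- The one-dimensional Brunn–Minkowski inequality. -/
theorem volume_add_volume_le {A B C : Set ℝ} (hA : MeasurableSet A) (hB : MeasurableSet B)
    (hAn : A.Nonempty) (hBn : B.Nonempty) (h : A + B ⊆ C) :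
    volume A + volume B ≤ volume C := by
  obtain ⟨a, ha⟩ := hAn
  obtain ⟨b, hb⟩ := hBn
  rw [hA.measure_eq_iSup_isCompact, hB.measure_eq_iSup_isCompact]
  simp only [iSup_and']
  refine ENNReal.biSup_add_biSup_le' ⟨{a}, by simpa using ha⟩ ⟨{b}, by simpa using hb⟩ ?_
  rintro K ⟨hKA, hK⟩ L ⟨hLB, hL⟩
  -- The approximating compact sets may be empty; inserting `a` and `b` makes them nonempty.
  refine le_trans (add_le_add (measure_mono (subset_insert a K)) (measure_mono (subset_insert b L)))
    (volume_add_volume_le_of_isCompact (hK.insert a) (hL.insert b) ⟨a, by simp⟩ ⟨b, by simp⟩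
      (le_trans (add_subset_add ?_ ?_) h))
  · exact insert_subset ha hKA
  · exact insert_subset hb hLB

theorem geom_mean_le_arith_mean (t : ℝ) (ht0 : 0 < t) (ht1 : t < 1) (x y : ℝ≥0∞) :
    x ^ (1 - t) * y ^ t ≤ ENNReal.ofReal (1 - t) * x + ENNReal.ofReal t * y := by
  have h1 : 0 < 1 - t := by linarith
  have h := ENNReal.young_inequality (x ^ (1 - t)) (y ^ t) (p := 1 / (1 - t)) (q := 1 / t)
    (by
      rw [Real.holderConjugate_iff]
      refine ⟨?_, ?_⟩
      · rw [lt_div_iff₀ h1]; linarith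
      · simp)
  rw [← ENNReal.rpow_mul, ← ENNReal.rpow_mul, mul_one_div_cancel h1.ne', mul_one_div_cancel ht0.ne',
    ENNReal.rpow_one, ENNReal.rpow_one, one_div, one_div, ENNReal.ofReal_inv_of_pos h1,
    ENNReal.ofReal_inv_of_pos ht0, div_eq_mul_inv, div_eq_mul_inv, inv_inv, inv_inv] at h
  rwa [mul_comm _ x, mul_comm _ y]

theorem volume_Ioi_ofReal_lt (c : ℝ≥0∞) :
    volume {t : ℝ | 0 < t ∧ ENNReal.ofReal t < c} = c := by
  induction c with
  | top =>
    have : {t : ℝ | 0 < t ∧ ENNReal.ofReal t < ∞} = Ioi 0 := by ext; simp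
    rw [this, Real.volume_Ioi]
  | coe c =>
    have : {t : ℝ | 0 < t ∧ ENNReal.ofReal t < c} = Ioo 0 (c : ℝ) := by
      ext t
      simp only [mem_ofPred_eq, mem_Ioo, and_congr_right_iff]
      intro ht
      rw [← ENNReal.ofReal_coe_nnreal, ENNReal.ofReal_lt_ofReal_iff_of_nonneg ht.le]
    rw [this]; simp

/-- The layer cake formula for functions with values in `[0, ∞]`. -/
theorem lintegral_layer_cake {α : Type*} [MeasurableSpace α] (μ : Measure α) [SFinite μ]
    {g : α → ℝ≥0∞} (hg : Measurable g) :
    ∫⁻ x, g x ∂μ = ∫⁻ t in Ioi (0 : ℝ), μ {x | ENNReal.ofReal t < g x} := by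
  have hm : MeasurableSet {p : α × ℝ | ENNReal.ofReal p.2 < g p.1} :=
    measurableSet_lt (by fun_prop) (by fun_prop)
  calc ∫⁻ x, g x ∂μ
      = ∫⁻ x, (∫⁻ t in Ioi (0 : ℝ),
          {p : α × ℝ | ENNReal.ofReal p.2 < g p.1}.indicator (1 : α × ℝ → ℝ≥0∞) (x, t)) ∂μ := by
        refine lintegral_congr fun x => ?_
        conv_lhs => rw [← volume_Ioi_ofReal_lt (g x)]
        have hmx : MeasurableSet {t : ℝ | ENNReal.ofReal t < g x} :=
          measurableSet_lt (by fun_prop) (by fun_prop)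
        have : ∀ t : ℝ, {p : α × ℝ | ENNReal.ofReal p.2 < g p.1}.indicator (1 : α × ℝ → ℝ≥0∞) (x, t)
            = {t : ℝ | ENNReal.ofReal t < g x}.indicator 1 t := fun t => by
          simp [indicator]
        simp_rw [this]
        rw [lintegral_indicator_one hmx, Measure.restrict_apply hmx]
        congr 1; ext t; simp [and_comm]
    _ = ∫⁻ t in Ioi (0 : ℝ), (∫⁻ x,
          {p : α × ℝ | ENNReal.ofReal p.2 < g p.1}.indicator (1 : α × ℝ → ℝ≥0∞) (x, t) ∂μ) :=
        lintegral_lintegral_swap (f := fun x t =>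
          {p : α × ℝ | ENNReal.ofReal p.2 < g p.1}.indicator (1 : α × ℝ → ℝ≥0∞) (x, t))
          ((measurable_one.indicator hm).aemeasurable)
    _ = _ := by
        refine lintegral_congr fun t => ?_
        have hmt : MeasurableSet {x | ENNReal.ofReal t < g x} :=
          measurableSet_lt (by fun_prop) (by fun_prop)
        rw [← lintegral_indicator_one hmt]
        refine lintegral_congr fun x => ?_
        simp [indicator]

/-- With both suprema equal to `1`, for `0 < s < 1` the sets `{f > s}` and `{g > s}` are nonempty
and their convex combination lies in `{h > s}`. One-dimensional Brunn–Minkowski at each level,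
integrated in `s`, gives an arithmetic mean on the left, which is stronger than the geometric one.
-/
theorem prekopa_leindler_real_of_iSup_eq_one {t : ℝ} (ht0 : 0 < t) (ht1 : t < 1)
    {f g h : ℝ → ℝ≥0∞} (hf : Measurable f) (hg : Measurable g) (hh : Measurable h)
    (hfs : ⨆ x, f x = 1) (hgs : ⨆ x, g x = 1)
    (H : ∀ x y, f x ^ (1 - t) * g y ^ t ≤ h ((1 - t) * x + t * y)) :
    ENNReal.ofReal (1 - t) * (∫⁻ x, f x) + ENNReal.ofReal t * (∫⁻ x, g x) ≤ ∫⁻ x, h x := by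
  have h1 : 0 < 1 - t := by linarith
  have key : ∀ {F : ℝ → ℝ≥0∞}, Measurable F → ⨆ x, F x = 1 →
      ∫⁻ x, F x = ∫⁻ s in Ioo (0 : ℝ) 1, volume {x | ENNReal.ofReal s < F x} := by
    intro F hF hF1
    rw [lintegral_layer_cake volume hF, ← Ioo_union_Ici_eq_Ioi one_pos,
      lintegral_union measurableSet_Ici (Set.disjoint_left.2 fun s hs hs' => not_le.2 hs.2 hs')]
    have : ∫⁻ s in Ici (1 : ℝ), volume {x | ENNReal.ofReal s < F x} = 0 := by
      rw [setLIntegral_congr_fun (g := fun _ => 0) measurableSet_Ici, lintegral_zero]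
      intro s hs
      have : {x | ENNReal.ofReal s < F x} = ∅ := by
        refine eq_empty_of_forall_notMem fun x hx => ?_
        have h2 : F x ≤ 1 := hF1 ▸ le_iSup F x
        have h3 : (1 : ℝ≥0∞) ≤ ENNReal.ofReal s := by simpa using hs
        exact absurd (lt_of_lt_of_le hx h2) (not_lt.2 h3)
      simp [this]
    rw [this, add_zero]
  have hmeas : ∀ {F : ℝ → ℝ≥0∞}, Measurable fun s : ℝ => volume {x | ENNReal.ofReal s < F x} := by
    intro F
    refine Antitone.measurable fun s s' hss => measure_mono fun x hx => ?_
    exact lt_of_le_of_lt (ENNReal.ofReal_le_ofReal hss) hx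
  rw [key hf hfs, key hg hgs, ← lintegral_const_mul _ hmeas, ← lintegral_const_mul _ hmeas,
    ← lintegral_add_left (hmeas.const_mul _), lintegral_layer_cake volume hh]
  refine le_trans (setLIntegral_mono hmeas fun s hs => ?_) (lintegral_mono_set Ioo_subset_Ioi_self)
  have hs1 : ENNReal.ofReal s < 1 := by simpa using hs.2
  have hs0 : ENNReal.ofReal s ≠ 0 := by simpa using hs.1
  have e1 : ENNReal.ofReal (1 - t) * volume {x | ENNReal.ofReal s < f x} =
      volume ((1 - t) • {x | ENNReal.ofReal s < f x}) := by
    rw [Measure.addHaar_smul]; simp [abs_of_pos h1]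
  have e2 : ENNReal.ofReal t * volume {x | ENNReal.ofReal s < g x} =
      volume (t • {x | ENNReal.ofReal s < g x}) := by
    rw [Measure.addHaar_smul]; simp [abs_of_pos ht0]
  rw [e1, e2]
  refine volume_add_volume_le ((measurableSet_lt measurable_const hf).const_smul₀ _)
    ((measurableSet_lt measurable_const hg).const_smul₀ _) ?_ ?_ ?_
  · obtain ⟨x, hx⟩ := lt_iSup_iff.1 (hfs ▸ hs1)
    exact ⟨_, smul_mem_smul_set hx⟩
  · obtain ⟨x, hx⟩ := lt_iSup_iff.1 (hgs ▸ hs1)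
    exact ⟨_, smul_mem_smul_set hx⟩
  · rintro _ ⟨_, ⟨x, hx, rfl⟩, _, ⟨y, hy, rfl⟩, rfl⟩
    refine lt_of_lt_of_le ?_ (H x y)
    calc ENNReal.ofReal s = ENNReal.ofReal s ^ (1 - t) * ENNReal.ofReal s ^ t := by
          rw [← ENNReal.rpow_add _ _ hs0 ENNReal.ofReal_ne_top]; simp
      _ < _ := ENNReal.mul_lt_mul (ENNReal.rpow_lt_rpow hx h1) (ENNReal.rpow_lt_rpow hy ht0)

/-- The hypothesis survives dividing `f`, `g`, `h` by `a`, `b`, `a^(1-t) b^t`; this reduces to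
suprema `1`, and the arithmetic–geometric mean inequality restores the homogeneous form. -/
theorem prekopa_leindler_real_of_iSup_lt_top {t : ℝ} (ht0 : 0 < t) (ht1 : t < 1)
    {f g h : ℝ → ℝ≥0∞} (hf : Measurable f) (hg : Measurable g) (hh : Measurable h)
    (hfs : ⨆ x, f x ≠ ∞) (hgs : ⨆ x, g x ≠ ∞)
    (H : ∀ x y, f x ^ (1 - t) * g y ^ t ≤ h ((1 - t) * x + t * y)) :
    (∫⁻ x, f x) ^ (1 - t) * (∫⁻ x, g x) ^ t ≤ ∫⁻ x, h x := by
  have h1 : 0 < 1 - t := by linarith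
  set a := ⨆ x, f x with ha
  set b := ⨆ x, g x with hb
  by_cases ha0 : a = 0
  · have : ∀ x, f x = 0 := fun x => le_antisymm ((le_iSup f x).trans_eq ha0) zero_le
    simp [this, h1]
  by_cases hb0 : b = 0
  · have : ∀ x, g x = 0 := fun x => le_antisymm ((le_iSup g x).trans_eq hb0) zero_le
    simp [this, ht0]
  have hab0 : a ^ (1 - t) * b ^ t ≠ 0 := by simp [ha0, hb0, hfs, hgs]
  have habt : a ^ (1 - t) * b ^ t ≠ ∞ := ENNReal.mul_ne_top
    (ENNReal.rpow_ne_top_of_nonneg h1.le hfs) (ENNReal.rpow_ne_top_of_nonneg ht0.le hgs)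
  have hinv : (a⁻¹) ^ (1 - t) * (b⁻¹) ^ t = (a ^ (1 - t) * b ^ t)⁻¹ := by
    rw [ENNReal.inv_rpow, ENNReal.inv_rpow,
      ENNReal.mul_inv (Or.inl (by simp [ha0, hfs])) (Or.inr (by simp [hb0, hgs]))]
  have key := prekopa_leindler_real_of_iSup_eq_one ht0 ht1 (f := fun x => a⁻¹ * f x)
    (g := fun x => b⁻¹ * g x) (h := fun x => (a ^ (1 - t) * b ^ t)⁻¹ * h x)
    (hf.const_mul _) (hg.const_mul _) (hh.const_mul _)
    (by rw [← ENNReal.mul_iSup]; exact ENNReal.inv_mul_cancel ha0 hfs)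
    (by rw [← ENNReal.mul_iSup]; exact ENNReal.inv_mul_cancel hb0 hgs)
    (fun x y => by
      rw [ENNReal.mul_rpow_of_nonneg _ _ h1.le, ENNReal.mul_rpow_of_nonneg _ _ ht0.le,
        mul_mul_mul_comm, hinv]
      gcongr; exact H x y)
  have key2 := (geom_mean_le_arith_mean t ht0 ht1 _ _).trans key
  rw [lintegral_const_mul _ hf, lintegral_const_mul _ hg, lintegral_const_mul _ hh,
    ENNReal.mul_rpow_of_nonneg _ _ h1.le, ENNReal.mul_rpow_of_nonneg _ _ ht0.le,
    mul_mul_mul_comm, hinv] at key2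
  rwa [ENNReal.mul_le_mul_iff_right (ENNReal.inv_ne_zero.2 habt) (ENNReal.inv_ne_top.2 hab0)]
    at key2

/-- The Prékopa–Leindler inequality on the line. -/
theorem prekopa_leindler_real {t : ℝ} (ht0 : 0 < t) (ht1 : t < 1)
    {f g h : ℝ → ℝ≥0∞} (hf : Measurable f) (hg : Measurable g) (hh : Measurable h)
    (H : ∀ x y, f x ^ (1 - t) * g y ^ t ≤ h ((1 - t) * x + t * y)) :
    (∫⁻ x, f x) ^ (1 - t) * (∫⁻ x, g x) ^ t ≤ ∫⁻ x, h x := by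
  have h1 : 0 < 1 - t := by linarith
  -- Truncating `f` and `g` at integer heights only lowers the left side of the hypothesis; monotone
  -- convergence removes the truncation.
  have hsup : ∀ {F : ℝ → ℝ≥0∞}, Measurable F →
      ∫⁻ x, F x = ⨆ n : ℕ, ∫⁻ x, min (F x) n := by
    intro F hF
    rw [← lintegral_iSup (fun n => hF.min measurable_const)]
    · refine lintegral_congr fun x => ?_
      change F x = ⨆ n : ℕ, F x ⊓ n
      rw [← inf_iSup_eq, ENNReal.iSup_natCast, inf_top_eq]
    · intro m n hmn x
      exact min_le_min le_rfl (by exact_mod_cast hmn)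
  have hpow : ∀ {p : ℝ}, 0 < p → ∀ F : ℕ → ℝ≥0∞, (⨆ n, F n) ^ p = ⨆ n, F n ^ p := fun hp F =>
    (ENNReal.orderIsoRpow _ hp).map_iSup F
  have hfin : ∀ (F : ℝ → ℝ≥0∞) (n : ℕ), ⨆ x, min (F x) n ≠ ∞ := fun F n =>
    ne_top_of_le_ne_top (ENNReal.natCast_ne_top n) (iSup_le fun x => min_le_right _ _)
  rw [hsup hf, hsup hg, hpow h1, hpow ht0, ENNReal.iSup_mul]
  simp_rw [ENNReal.mul_iSup]
  exact iSup_le fun m => iSup_le fun n => prekopa_leindler_real_of_iSup_lt_top ht0 ht1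
    (hf.min measurable_const) (hg.min measurable_const) hh (hfin f m) (hfin g n) fun x y =>
    (mul_le_mul' (ENNReal.rpow_le_rpow (min_le_left _ _) h1.le)
      (ENNReal.rpow_le_rpow (min_le_left _ _) ht0.le)).trans (H x y)

/-- The Prékopa–Leindler inequality. -/
theorem prekopa_leindler {t : ℝ} (ht0 : 0 < t) (ht1 : t < 1) (n : ℕ)
    {f g h : (Fin n → ℝ) → ℝ≥0∞} (hf : Measurable f) (hg : Measurable g) (hh : Measurable h)
    (H : ∀ x y, f x ^ (1 - t) * g y ^ t ≤ h ((1 - t) • x + t • y)) :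
    (∫⁻ x, f x) ^ (1 - t) * (∫⁻ x, g x) ^ t ≤ ∫⁻ x, h x := by
  induction n with
  | zero =>
    have hv : (volume : Measure (Fin 0 → ℝ)) = Measure.dirac default := by
      rw [volume_pi, Measure.pi_of_empty _ default]
    simp only [hv, lintegral_dirac]
    convert H default default
  | succ n ih =>
    set e := MeasurableEquiv.piFinSuccAbove (fun _ : Fin (n + 1) => ℝ) 0 with he
    have hint : ∀ {F : (Fin (n + 1) → ℝ) → ℝ≥0∞}, Measurable F →
        ∫⁻ x, F x = ∫⁻ s : ℝ, ∫⁻ x : Fin n → ℝ, F (e.symm (s, x)) := by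
      intro F hF
      rw [← ((volume_preserving_piFinSuccAbove (fun _ : Fin (n + 1) => ℝ) 0).symm _).lintegral_comp
        hF, Measure.volume_eq_prod, lintegral_prod _ (by fun_prop)]
    have hadd : ∀ (s s' : ℝ) (x y : Fin n → ℝ), (1 - t) • e.symm (s, x) + t • e.symm (s', y) =
        e.symm ((1 - t) * s + t * s', (1 - t) • x + t • y) := by
      intro s s' x y
      ext i
      refine Fin.cases ?_ (fun j => ?_) i <;>
        simp [he, MeasurableEquiv.piFinSuccAbove, Fin.insertNthEquiv]
    have hslice : ∀ {F : (Fin (n + 1) → ℝ) → ℝ≥0∞}, Measurable F →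
        Measurable fun s : ℝ => ∫⁻ x : Fin n → ℝ, F (e.symm (s, x)) := fun hF =>
      (hF.comp e.symm.measurable).lintegral_prod_right'
    have hsl : ∀ {F : (Fin (n + 1) → ℝ) → ℝ≥0∞}, Measurable F → ∀ s : ℝ,
        Measurable fun x : Fin n → ℝ => F (e.symm (s, x)) := fun hF s =>
      (hF.comp e.symm.measurable).comp measurable_prodMk_left
    rw [hint hf, hint hg, hint hh]
    -- The induction hypothesis on slices is exactly the one-dimensional hypothesis for the slice
    -- integrals.
    refine prekopa_leindler_real ht0 ht1 (hslice hf) (hslice hg) (hslice hh) fun s s' => ?_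
    refine ih (hsl hf s) (hsl hg s') (hsl hh _) fun x y => ?_
    rw [← hadd]
    exact H _ _

/-- The multiplicative form of the Brunn–Minkowski inequality. -/
theorem brunn_minkowski_mul {N : ℕ} {t : ℝ} (ht0 : 0 < t) (ht1 : t < 1) {A B C : Set (Space N)}
    (hA : MeasurableSet A) (hB : MeasurableSet B) (hC : MeasurableSet C)
    (H : (1 - t) • A + t • B ⊆ C) : volume A ^ (1 - t) * volume B ^ t ≤ volume C := by
  have h1 : 0 < 1 - t := by linarith
  have hv : ∀ {S : Set (Space N)}, MeasurableSet S →
      volume S = ∫⁻ x : Fin N → ℝ, S.indicator 1 (WithLp.toLp 2 x) := by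
    intro S hS
    rw [← lintegral_indicator_one hS]
    exact ((PiLp.volume_preserving_toLp (Fin N)).lintegral_comp
      (measurable_one.indicator hS)).symm
  have hm : ∀ {S : Set (Space N)}, MeasurableSet S →
      Measurable fun x : Fin N → ℝ => S.indicator (1 : Space N → ℝ≥0∞) (WithLp.toLp 2 x) :=
    fun hS => (measurable_one.indicator hS).comp (PiLp.volume_preserving_toLp (Fin N)).measurable
  rw [hv hA, hv hB, hv hC]
  refine prekopa_leindler ht0 ht1 N (hm hA) (hm hB) (hm hC) fun x y => ?_
  by_cases hx : WithLp.toLp 2 x ∈ A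
  · by_cases hy : WithLp.toLp 2 y ∈ B
    · have : WithLp.toLp 2 ((1 - t) • x + t • y) ∈ C :=
        H (add_mem_add (smul_mem_smul_set hx) (smul_mem_smul_set hy))
      simp only [indicator_of_mem hx, indicator_of_mem hy, indicator_of_mem this]
      simp
    · simp [indicator_of_notMem hy, ht0]
  · simp [indicator_of_notMem hx, h1]

/-- The Brunn–Minkowski inequality for a set and a ball. -/
theorem brunn_minkowski_thickening {N : ℕ} (hN : 2 ≤ N) {A : Set (Space N)} (hA : MeasurableSet A)
    (hAf : volume A ≠ ∞) {ε : ℝ} (hε : 0 < ε) :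
    volume A + N * ENNReal.ofReal ε * volume (Metric.ball (0 : Space N) 1) ^ (1 / (N : ℝ)) *
      volume A ^ (((N : ℝ) - 1) / N) ≤ volume (Metric.thickening ε A) := by
  have hN0 : (0 : ℝ) < N := by positivity
  have hN1 : (2 : ℝ) ≤ N := by exact_mod_cast hN
  by_cases hA0 : volume A = 0
  · have : 0 < ((N : ℝ) - 1) / N := by apply div_pos <;> linarith
    simp [hA0, this]
  have hω0 : volume (Metric.ball (0 : Space N) 1) ≠ 0 :=
    (Metric.measure_ball_pos _ _ one_pos).ne'
  have hωt : volume (Metric.ball (0 : Space N) 1) ≠ ∞ := measure_ball_lt_top.ne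
  set ω := volume (Metric.ball (0 : Space N) 1)
  obtain ⟨a, ha0, ha⟩ : ∃ a : ℝ, 0 < a ∧ volume A = ENNReal.ofReal (a ^ N) := by
    refine ⟨(volume A).toReal ^ (1 / (N : ℝ)), Real.rpow_pos_of_pos
      (ENNReal.toReal_pos hA0 hAf) _, ?_⟩
    rw [← Real.rpow_mul_natCast ENNReal.toReal_nonneg, one_div_mul_cancel hN0.ne', Real.rpow_one,
      ENNReal.ofReal_toReal hAf]
  obtain ⟨r, hr0, hr⟩ : ∃ a : ℝ, 0 < a ∧ ω = ENNReal.ofReal (a ^ N) := by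
    refine ⟨ω.toReal ^ (1 / (N : ℝ)), Real.rpow_pos_of_pos
      (ENNReal.toReal_pos hω0 hωt) _, ?_⟩
    rw [← Real.rpow_mul_natCast ENNReal.toReal_nonneg, one_div_mul_cancel hN0.ne', Real.rpow_one,
      ENNReal.ofReal_toReal hωt]
  -- With `|A| = a^N` and `ω = r^N`, this `t` gives `(1 - t)⁻¹ A` and `t⁻¹ B_ε` the same volume `(a
  -- + εr)^N`, so the multiplicative form yields the full bound `(a + εr)^N`.
  set t := ε * r / (a + ε * r) with ht
  have hs : 0 < a + ε * r := by positivity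
  have ht0 : 0 < t := by positivity
  have h1t : 1 - t = a / (a + ε * r) := by rw [ht]; field_simp; ring
  have h1t0 : 0 < 1 - t := by rw [h1t]; positivity
  have e1 : volume ((1 - t)⁻¹ • A) = ENNReal.ofReal ((a + ε * r) ^ N) := by
    rw [Measure.addHaar_smul, ha, ← ENNReal.ofReal_mul (abs_nonneg _),
      abs_of_nonneg (by positivity), h1t]
    congr 1
    rw [finrank_euclideanSpace_fin, inv_pow, ← inv_pow, ← mul_pow]
    congr 1
    field_simp
  have e2 : volume (t⁻¹ • Metric.ball (0 : Space N) ε) = ENNReal.ofReal ((a + ε * r) ^ N) := by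
    rw [Measure.addHaar_smul, Measure.addHaar_ball_of_pos _ _ hε]
    change _ * (_ * ω) = _
    rw [hr, ← ENNReal.ofReal_mul (by positivity),
      ← ENNReal.ofReal_mul (abs_nonneg _), abs_of_nonneg (by positivity), ht]
    congr 1
    rw [finrank_euclideanSpace_fin, inv_pow, ← inv_pow, ← mul_pow, ← mul_pow]
    congr 1
    field_simp
  have key := brunn_minkowski_mul ht0 (by linarith) (A := (1 - t)⁻¹ • A)
    (B := t⁻¹ • Metric.ball (0 : Space N) ε) (C := Metric.thickening ε A)
    (hA.const_smul₀ _) (Metric.isOpen_ball.measurableSet.const_smul₀ _)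
    Metric.isOpen_thickening.measurableSet (by
      rw [smul_inv_smul₀ h1t0.ne', smul_inv_smul₀ ht0.ne', add_ball_zero])
  rw [e1, e2, ← ENNReal.rpow_add _ _ (by simp; positivity) ENNReal.ofReal_ne_top, sub_add_cancel,
    ENNReal.rpow_one] at key
  refine le_trans ?_ key
  have e3 : ω ^ (1 / (N : ℝ)) = ENNReal.ofReal r := by
    rw [hr, ENNReal.ofReal_rpow_of_nonneg (by positivity) (by positivity), one_div,
      Real.pow_rpow_inv_natCast hr0.le (by positivity)]
  have e4 : volume A ^ (((N : ℝ) - 1) / N) = ENNReal.ofReal (a ^ (N - 1)) := by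
    rw [ha, ENNReal.ofReal_rpow_of_nonneg (by positivity) (div_nonneg (by linarith) hN0.le),
      ← Real.rpow_natCast_mul ha0.le, mul_div_cancel₀ _ hN0.ne', ← Real.rpow_natCast a (N - 1),
      Nat.cast_sub (by omega)]
    simp
  rw [e3, e4, ha, ← ENNReal.ofReal_natCast, ← ENNReal.ofReal_mul (by positivity),
    ← ENNReal.ofReal_mul (by positivity), ← ENNReal.ofReal_mul (by positivity),
    ← ENNReal.ofReal_add (by positivity) (by positivity)]
  refine ENNReal.ofReal_le_ofReal ?_
  -- Bernoulli keeps the term of first order in `ε`, which is all that the limit `ε → 0` needs.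
  have hb := one_add_mul_le_pow (a := ε * r / a) (le_trans (by norm_num) (by positivity : (0 : ℝ) ≤ _)) N
  have h5 : a ^ N * (1 + N * (ε * r / a)) ≤ a ^ N * (1 + ε * r / a) ^ N := by gcongr
  have h6 : a ^ N * (1 + ε * r / a) ^ N = (a + ε * r) ^ N := by
    rw [← mul_pow]; congr 1; field_simp
  have h7 : a ^ N = a * a ^ (N - 1) := by rw [← pow_succ']; congr 1; omega
  rw [h6] at h5
  refine le_trans (le_of_eq ?_) h5
  rw [h7]; field_simp

end ConvDiff

namespace ConvDiff

open Set

/-! ### The isoperimetric inequality for superlevel sets -/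

/-- The sup-convolution `x ↦ sup {f y : |y - x| < ε}`. -/
noncomputable def supConv {N : ℕ} (f : Space N → ℝ) (ε : ℝ) (x : Space N) : ℝ :=
  sSup (f '' Metric.ball x ε)

/-- Superlevel sets of the sup-convolution are thickenings of those of `f`, so Brunn–Minkowski
applies level by level; they are open, whence measurability even for nonmeasurable `f`. -/
theorem lt_supConv_iff {N : ℕ} {f : Space N → ℝ} (hf : BddAbove (range f)) {ε : ℝ} (hε : 0 < ε)
    {x : Space N} {s : ℝ} : s < supConv f ε x ↔ x ∈ Metric.thickening ε {y | s < f y} := by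
  rw [supConv, lt_csSup_iff (hf.mono (image_subset_range _ _))
    ((Metric.nonempty_ball.2 hε).image _), Metric.mem_thickening_iff]
  constructor
  · rintro ⟨_, ⟨y, hy, rfl⟩, hs⟩
    exact ⟨y, hs, by rwa [dist_comm]⟩
  · rintro ⟨y, hs, hy⟩
    exact ⟨_, ⟨y, by rwa [Metric.mem_ball, dist_comm], rfl⟩, hs⟩

theorem measurable_supConv {N : ℕ} {f : Space N → ℝ} (hf : BddAbove (range f)) {ε : ℝ}
    (hε : 0 < ε) : Measurable (supConv f ε) := by
  refine measurable_of_Ioi fun s => ?_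
  have : supConv f ε ⁻¹' Ioi s = Metric.thickening ε {y | s < f y} := by
    ext x; exact lt_supConv_iff hf hε
  rw [this]
  exact Metric.isOpen_thickening.measurableSet

theorem le_supConv {N : ℕ} {f : Space N → ℝ} (hf : BddAbove (range f)) {ε : ℝ}
    (hε : 0 < ε) (x : Space N) : f x ≤ supConv f ε x :=
  le_csSup (hf.mono (image_subset_range _ _)) ⟨x, Metric.mem_ball_self hε, rfl⟩

theorem supConv_le {N : ℕ} {f : Space N → ℝ} {ε : ℝ} (hε : 0 < ε) {x : Space N} {m : ℝ}
    (h : ∀ y ∈ Metric.ball x ε, f y ≤ m) : supConv f ε x ≤ m := by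
  refine csSup_le ((Metric.nonempty_ball.2 hε).image _) ?_
  rintro _ ⟨y, hy, rfl⟩
  exact h y hy

theorem setLIntegral_Ioi_zero_comp_add (F : ℝ → ℝ≥0∞) (a : ℝ) :
    ∫⁻ t in Ioi (0 : ℝ), F (t + a) = ∫⁻ s in Ioi a, F s := by
  have h := (measurePreserving_add_right (volume : Measure ℝ) a).setLIntegral_comp_preimage_emb
    (measurableEmbedding_addRight a) F (Ioi a)
  rw [← h]
  congr 2
  ext t; simp

theorem lintegral_ofReal_sub {N : ℕ} {g : Space N → ℝ} (hg : Measurable g) (a : ℝ) :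
    ∫⁻ x, ENNReal.ofReal (g x - a) = ∫⁻ s in Ioi a, volume {x | s < g x} := by
  rw [lintegral_layer_cake volume (by fun_prop),
    ← setLIntegral_Ioi_zero_comp_add (fun s => volume {x | s < g x}) a]
  refine setLIntegral_congr_fun measurableSet_Ioi fun t ht => ?_
  have ht' : (0 : ℝ) ≤ t := le_of_lt ht
  congr 1; ext x
  simp only [mem_ofPred_eq]
  rw [ENNReal.ofReal_lt_ofReal_iff_of_nonneg ht', lt_sub_iff_add_lt]

/-- The isoperimetric inequality `N ω_N^{1/N} ∫_a^∞ |{|u| > s}|^{(N-1)/N} ds ≤ ∫_{|u| ≥ a} |Du|`. -/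
theorem isoperimetric_superlevel {N : ℕ} (hN : 2 ≤ N) {u : Space N → ℂ} (hu : ContDiff ℝ 1 u)
    (hc : HasCompactSupport u) {a : ℝ} (ha : 0 ≤ a) :
    N * volume (Metric.ball (0 : Space N) 1) ^ (1 / (N : ℝ)) *
      ∫⁻ s in Ioi a, volume {x | s < ‖u x‖} ^ (((N : ℝ) - 1) / N) ≤
      ∫⁻ x in {x | a ≤ ‖u x‖}, ‖fderiv ℝ u x‖ₑ := by
  obtain ⟨L, hL⟩ := hu.lipschitzWith_of_hasCompactSupport hc one_ne_zero
  have hcont : Continuous fun x => ‖u x‖ := hu.continuous.norm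
  set f : Space N → ℝ := fun x => ‖u x‖ with hf
  have hfm : Measurable f := hcont.measurable
  have hb : BddAbove (range f) := by
    obtain ⟨M, hM⟩ := hc.exists_bound_of_continuous hu.continuous
    exact ⟨M, by rintro _ ⟨x, rfl⟩; exact hM x⟩
  have hfL : ∀ x y, f y ≤ f x + L * dist y x := by
    intro x y
    have h1 := hL.dist_le_mul y x
    have h2 : f y ≤ f x + ‖u y - u x‖ := by
      have := norm_add_le (u x) (u y - u x)
      simpa [hf] using this
    rw [dist_eq_norm] at h1
    linarith
  -- `q ε` is the difference quotient in `ε` of `(sup_{B_ε(x)} f - a)⁺`. Brunn–Minkowski bounds its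
  -- integral from below for each `ε`, while its upper limit is at most `|Du|` where `f ≥ a` and `0`
  -- elsewhere.
  set p : Space N → ℝ≥0∞ := fun x => ENNReal.ofReal (f x - a) with hp
  set q : ℝ → Space N → ℝ≥0∞ := fun ε x =>
    (ENNReal.ofReal ε)⁻¹ * (ENNReal.ofReal (supConv f ε x - a) - p x) with hq
  have hpm : Measurable p := by fun_prop
  have hqm : ∀ ε, 0 < ε → Measurable (q ε) := fun ε hε => by
    have := measurable_supConv hb hε
    fun_prop
  have hS : volume (tsupport u) ≠ ∞ := hc.isCompact.measure_lt_top.ne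
  -- Finiteness allows `∫ p` to be cancelled in `hBM`.
  have hpfin : ∫⁻ x, p x ≠ ∞ := by
    have h1 : Continuous fun x => max (f x - a) 0 := by fun_prop
    have h2 : HasCompactSupport fun x => max (f x - a) 0 := by
      refine hc.mono fun x hx => ?_
      contrapose! hx
      simp only [Function.mem_support, ne_eq, not_not] at hx
      simp [hf, hx, ha]
    have h3 := (h1.integrable_of_hasCompactSupport (μ := volume) h2).lintegral_lt_top
    refine ne_of_lt (lt_of_le_of_lt (lintegral_mono fun x => ?_) h3)
    exact ENNReal.ofReal_le_ofReal (le_max_left _ _)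
  have hq_le : ∀ {ε m : ℝ} {x : Space N}, 0 < ε → 0 ≤ m →
      (∀ y ∈ Metric.ball x ε, f y ≤ f x + m * ε) → q ε x ≤ ENNReal.ofReal m := by
    intro ε m x hε hm h
    have h1 := supConv_le hε h
    have h2 : ENNReal.ofReal (supConv f ε x - a) - p x ≤ ENNReal.ofReal ε * ENNReal.ofReal m := by
      rw [tsub_le_iff_right, hp, ← ENNReal.ofReal_mul hε.le]
      refine le_trans (ENNReal.ofReal_le_ofReal ?_) ENNReal.ofReal_add_le
      linarith
    calc q ε x ≤ (ENNReal.ofReal ε)⁻¹ * (ENNReal.ofReal ε * ENNReal.ofReal m) :=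
          mul_le_mul' le_rfl h2
      _ = ENNReal.ofReal m := by
          rw [← mul_assoc, ENNReal.inv_mul_cancel (by simpa using hε) ENNReal.ofReal_ne_top, one_mul]
  have hq_zero : ∀ {ε : ℝ} {x : Space N}, 0 < ε → (∀ y ∈ Metric.ball x ε, f y ≤ a) →
      q ε x = 0 := by
    intro ε x hε h
    have h1 := supConv_le hε h
    have : ENNReal.ofReal (supConv f ε x - a) = 0 := by simpa using h1
    simp [hq, this]
  -- the lower bound given by the Brunn–Minkowski inequality
  have hBM : ∀ ε : ℝ, 0 < ε →
      N * volume (Metric.ball (0 : Space N) 1) ^ (1 / (N : ℝ)) *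
        ∫⁻ s in Ioi a, volume {x | s < f x} ^ (((N : ℝ) - 1) / N) ≤ ∫⁻ x, q ε x := by
    intro ε hε
    have hε0 : ENNReal.ofReal ε ≠ 0 := by simpa using hε
    have hmono : Antitone fun s : ℝ => volume {x | s < f x} := fun s s' hss =>
      measure_mono fun x hx => lt_of_le_of_lt hss hx
    have h1 : ∫⁻ x, ENNReal.ofReal (supConv f ε x - a) =
        (∫⁻ x, p x) + ENNReal.ofReal ε * ∫⁻ x, q ε x := by
      rw [← lintegral_const_mul _ (hqm ε hε), ← lintegral_add_left hpm]
      refine lintegral_congr fun x => ?_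
      rw [hq, ← mul_assoc, ENNReal.mul_inv_cancel hε0 ENNReal.ofReal_ne_top, one_mul,
        add_tsub_cancel_of_le]
      exact ENNReal.ofReal_le_ofReal (sub_le_sub_right (le_supConv hb hε x) _)
    have h2 : (∫⁻ x, p x) + ENNReal.ofReal ε *
        (N * volume (Metric.ball (0 : Space N) 1) ^ (1 / (N : ℝ)) *
        ∫⁻ s in Ioi a, volume {x | s < f x} ^ (((N : ℝ) - 1) / N)) ≤
        ∫⁻ x, ENNReal.ofReal (supConv f ε x - a) := by
      rw [lintegral_ofReal_sub (measurable_supConv hb hε), hp, lintegral_ofReal_sub hfm,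
        ← mul_assoc, ← lintegral_const_mul _ (hmono.measurable.pow_const _),
        ← lintegral_add_left hmono.measurable]
      refine setLIntegral_mono' measurableSet_Ioi fun s hs => ?_
      have hs0 : 0 < s := lt_of_le_of_lt ha hs
      have hfin : volume {x | s < f x} ≠ ∞ := by
        refine measure_ne_top_of_subset (fun x hx => subset_tsupport _ ?_) hS
        rw [Function.mem_support]
        intro h0
        simp only [hf, mem_ofPred_eq, h0, norm_zero] at hx
        exact absurd hx (not_lt.2 hs0.le)
      have hB := brunn_minkowski_thickening hN (measurableSet_lt measurable_const hfm) hfin hε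
      have : {x | s < supConv f ε x} = Metric.thickening ε {x | s < f x} := by
        ext x; exact lt_supConv_iff hb hε
      rw [this]
      refine le_trans (le_of_eq ?_) hB
      ring
    rw [h1] at h2
    have h3 := (ENNReal.add_le_add_iff_left hpfin).1 h2
    exact (ENNReal.mul_le_mul_iff_right hε0 ENNReal.ofReal_ne_top).1 h3
  set ε : ℕ → ℝ := fun n => 1 / ((n : ℝ) + 1) with hε
  have hεpos : ∀ n, 0 < ε n := fun n => by positivity
  have hεle : ∀ n, ε n ≤ 1 := fun n => by
    rw [hε, div_le_one (by positivity)]; linarith [(Nat.cast_nonneg n : (0 : ℝ) ≤ n)]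
  have hεlim : Tendsto ε atTop (𝓝 0) := tendsto_one_div_add_atTop_nhds_zero_nat
  have hεev : ∀ r : ℝ, 0 < r → ∀ᶠ n in atTop, ε n < r := fun r hr =>
    hεlim.eventually (gt_mem_nhds hr)
  -- Reverse Fatou: since `ε n ≤ 1`, the quotients are dominated by the Lipschitz constant on the
  -- closed `1`-neighbourhood of the support.
  have hlim := limsup_lintegral_le (μ := (volume : Measure (Space N))) (f := fun n => q (ε n))
    ((Metric.cthickening 1 (tsupport u)).indicator fun _ => ENNReal.ofReal L)
    (fun n => hqm _ (hεpos n)) (fun n => Eventually.of_forall fun x => by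
      by_cases hx : x ∈ Metric.cthickening 1 (tsupport u)
      · rw [indicator_of_mem hx]
        refine hq_le (hεpos n) L.2 fun y hy => (hfL x y).trans ?_
        have : dist y x ≤ ε n := le_of_lt hy
        gcongr
      · rw [indicator_of_notMem hx, nonpos_iff_eq_zero]
        refine hq_zero (hεpos n) fun y hy => ?_
        have hy' : y ∉ tsupport u := fun hyt => hx
          (Metric.mem_cthickening_of_dist_le x y 1 _ hyt
            (by rw [dist_comm]; exact (le_of_lt hy).trans (hεle n)))
        rw [hf]
        simpa [image_eq_zero_of_notMem_tsupport hy'] using ha)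
    (by
      rw [lintegral_indicator_const Metric.isClosed_cthickening.measurableSet]
      exact ENNReal.mul_ne_top ENNReal.ofReal_ne_top
        (hc.isCompact.isBounded.cthickening.measure_lt_top.ne))
  have hle : N * volume (Metric.ball (0 : Space N) 1) ^ (1 / (N : ℝ)) *
      ∫⁻ s in Ioi a, volume {x | s < f x} ^ (((N : ℝ) - 1) / N) ≤
      limsup (fun n => ∫⁻ x, q (ε n) x) atTop :=
    le_limsup_of_frequently_le (Frequently.of_forall fun n => hBM _ (hεpos n))
  refine (hle.trans hlim).trans ?_
  rw [← lintegral_indicator (measurableSet_le measurable_const hfm)]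
  refine lintegral_mono fun x => ?_
  by_cases hx : x ∈ {x | a ≤ f x}
  · rw [indicator_of_mem hx]
    refine ENNReal.le_of_forall_pos_le_add fun δ hδ _ => ?_
    have hδ' : (0 : ℝ) < δ := hδ
    have hd := ((hu.differentiable one_ne_zero) x).hasFDerivAt.isLittleO.def hδ'
    obtain ⟨r, hr, hball⟩ := Metric.eventually_nhds_iff.1 hd
    have : ENNReal.ofReal (‖fderiv ℝ u x‖ + δ) = ‖fderiv ℝ u x‖ₑ + δ := by
      rw [ENNReal.ofReal_add (norm_nonneg _) hδ'.le, ofReal_norm, ENNReal.ofReal_coe_nnreal]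
    rw [← this]
    refine limsup_le_of_le (by isBoundedDefault) ?_
    filter_upwards [hεev r hr] with n hn
    refine hq_le (hεpos n) (by positivity) fun y hy => ?_
    have hyx : dist y x < ε n := hy
    have h1 := hball (hyx.trans hn)
    have h2 : ‖u y‖ ≤ ‖u x‖ + ‖fderiv ℝ u x (y - x)‖ + ‖u y - u x - fderiv ℝ u x (y - x)‖ := by
      calc ‖u y‖ = ‖u x + fderiv ℝ u x (y - x) + (u y - u x - fderiv ℝ u x (y - x))‖ := by
            congr 1; ring
        _ ≤ _ := (norm_add_le _ _).trans (by gcongr; exact norm_add_le _ _)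
    have h3 := (fderiv ℝ u x).le_opNorm (y - x)
    have h4 : (‖fderiv ℝ u x‖ + δ) * ‖y - x‖ ≤ (‖fderiv ℝ u x‖ + δ) * ε n := by
      rw [← dist_eq_norm]; gcongr
    simp only [hf]
    nlinarith
  · rw [indicator_of_notMem hx]
    have hx' : 0 < a - f x := by simpa using hx
    refine limsup_le_of_le (by isBoundedDefault) ?_
    filter_upwards [hεev ((a - f x) / (L + 1)) (by positivity)] with n hn
    refine le_of_eq (hq_zero (hεpos n) fun y hy => (hfL x y).trans ?_)
    have hyx : dist y x < ε n := hy
    rw [lt_div_iff₀ (by positivity)] at hn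
    have : (L : ℝ) * dist y x ≤ L * ε n := by gcongr
    have := hεpos n
    nlinarith

end ConvDiff

namespace ConvDiff

open Set

/-! ### The Hardy–Lorentz inequality -/

/-- An upper set either is a closed half-line or is a directed union of closed half-lines with
rational endpoints, where continuity from below applies. This lets monotone functions with jumps
serve as weights. -/
theorem measure_le_of_isUpperSet {U : Set ℝ} (hU : IsUpperSet U) (ρ : Measure ℝ) {b : ℝ≥0∞}
    (h : ∀ r ∈ U, ρ (Ici r) ≤ b) : ρ U ≤ b := by
  by_cases hl : ∃ r, IsLeast U r
  · obtain ⟨r, hr, hr'⟩ := hl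
    have : U = Ici r := Subset.antisymm (fun x hx => hr' hx) fun x hx => hU hx hr
    rw [this]; exact h r hr
  · have hlt : ∀ s ∈ U, ∃ s' ∈ U, s' < s := by
      intro s hs
      by_contra! hcon
      exact hl ⟨s, hs, fun x hx => hcon x hx⟩
    have : U = ⋃ q : {q : ℚ // (q : ℝ) ∈ U}, Ici (q : ℝ) := by
      refine Subset.antisymm (fun s hs => ?_) (iUnion_subset fun q x hx => hU hx q.2)
      obtain ⟨s', hs', hlt'⟩ := hlt s hs
      obtain ⟨q, hq1, hq2⟩ := exists_rat_btwn hlt'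
      exact mem_iUnion.2 ⟨⟨q, hU hq1.le hs'⟩, hq2.le⟩
    rw [this, Directed.measure_iUnion]
    · exact iSup_le fun q => h q q.2
    · intro p q
      rcases le_total (p : ℚ) q with hpq | hpq
      · exact ⟨p, subset_rfl, Ici_subset_Ici.2 (by exact_mod_cast hpq)⟩
      · exact ⟨q, Ici_subset_Ici.2 (by exact_mod_cast hpq), subset_rfl⟩

theorem measurableSet_of_isUpperSet {U : Set ℝ} (hU : IsUpperSet U) : MeasurableSet U :=
  hU.ordConnected.measurableSet

/-- `|{x : |{f ≥ f x}| < τ}| ≤ τ`. -/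
theorem measure_measure_superlevel_lt {α : Type*} [MeasurableSpace α] (μ : Measure α) {f : α → ℝ}
    (hf : Measurable f) (τ : ℝ≥0∞) : μ {x | μ {y | f x ≤ f y} < τ} ≤ τ := by
  have hU : IsUpperSet {s : ℝ | μ {y | s ≤ f y} < τ} := fun s s' hss hs =>
    lt_of_le_of_lt (measure_mono fun y hy => le_trans hss hy) hs
  have h := measure_le_of_isUpperSet hU (μ.map f) (b := τ) fun r hr => by
    rw [Measure.map_apply hf measurableSet_Ici]
    exact le_of_lt hr
  rwa [Measure.map_apply hf (measurableSet_of_isUpperSet hU)] at h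

/-- The square of a function in weak `L^N` is integrated over a set `A` with the bound
`N / (N - 2) w² |A|^{(N-2)/N}`. -/
theorem setLIntegral_sq_le_of_weak {α : Type*} [MeasurableSpace α] {μ : Measure α} [SFinite μ]
    {N : ℕ} (hN : 3 ≤ N) {g : α → ℝ≥0∞} (hg : Measurable g) {w : ℝ} (hw : 0 < w)
    (h : ∀ t : ℝ, 0 < t → μ {x | ENNReal.ofReal t < g x} ≤ ENNReal.ofReal ((w / t) ^ N))
    {A : Set α} (hAf : μ A ≠ ∞) :
    ∫⁻ x in A, g x ^ 2 ∂μ ≤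
      ENNReal.ofReal (N / (N - 2) * w ^ 2) * μ A ^ (((N : ℝ) - 2) / N) := by
  have hN3 : (3 : ℝ) ≤ N := by exact_mod_cast hN
  have hN0 : (0 : ℝ) < N := by linarith
  by_cases hA0 : μ A = 0
  · rw [Measure.restrict_eq_zero.2 hA0]; simp
  obtain ⟨m, hm0, hm⟩ : ∃ m : ℝ, 0 < m ∧ μ A = ENNReal.ofReal (m ^ N) := by
    refine ⟨(μ A).toReal ^ (1 / (N : ℝ)), Real.rpow_pos_of_pos
      (ENNReal.toReal_pos hA0 hAf) _, ?_⟩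
    rw [← Real.rpow_mul_natCast ENNReal.toReal_nonneg, one_div_mul_cancel hN0.ne', Real.rpow_one,
      ENNReal.ofReal_toReal hAf]
  have hroot : μ A ^ (((N : ℝ) - 2) / N) = ENNReal.ofReal (m ^ (N - 2)) := by
    rw [hm, ENNReal.ofReal_rpow_of_nonneg (by positivity) (div_nonneg (by linarith) hN0.le),
      ← Real.rpow_natCast_mul hm0.le, mul_div_cancel₀ _ hN0.ne', ← Real.rpow_natCast m (N - 2),
      Nat.cast_sub (by omega)]
    simp
  -- `T` is the level where the bounds `|A| = m^N` and `(w/√t)^N` coincide. The lower levels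
  -- contribute `w² m^{N-2}` and the upper ones `2/(N-2)` times that; the tail converges because `N
  -- > 2`.
  set T := (w / m) ^ 2 with hT
  have hT0 : 0 < T := by positivity
  have hexp : -(N : ℝ) / 2 < -1 := by linarith
  have hpow : ∀ t : ℝ, 0 < t → (w / √t) ^ N = w ^ N * t ^ (-(N : ℝ) / 2) := by
    intro t ht
    rw [div_pow, Real.sqrt_eq_rpow, ← Real.rpow_mul_natCast ht.le, div_eq_mul_inv,
      ← Real.rpow_neg ht.le]
    congr 2; ring
  have hb1 : ∀ t : ℝ, (μ.restrict A) {x | ENNReal.ofReal t < g x ^ 2} ≤ ENNReal.ofReal (m ^ N) :=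
    fun t => (measure_mono (subset_univ _)).trans (by rw [Measure.restrict_apply_univ, hm])
  have hb2 : ∀ t : ℝ, 0 < t → (μ.restrict A) {x | ENNReal.ofReal t < g x ^ 2} ≤
      ENNReal.ofReal (w ^ N * t ^ (-(N : ℝ) / 2)) := by
    intro t ht
    rw [← hpow t ht]
    refine le_trans (Measure.restrict_apply_le _ _) (le_trans (measure_mono fun x hx => ?_)
      (h (√t) (Real.sqrt_pos.2 ht)))
    by_contra hcon
    have h1 : g x ≤ ENNReal.ofReal √t := not_lt.1 hcon
    have h2 : g x ^ 2 ≤ ENNReal.ofReal t := by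
      calc g x ^ 2 ≤ ENNReal.ofReal √t ^ 2 := by gcongr
        _ = ENNReal.ofReal t := by
          rw [← ENNReal.ofReal_pow (Real.sqrt_nonneg _), Real.sq_sqrt ht.le]
    exact absurd hx (not_lt.2 h2)
  rw [lintegral_layer_cake _ (by fun_prop), ← Ioc_union_Ioi_eq_Ioi hT0.le,
    lintegral_union measurableSet_Ioi (Ioc_disjoint_Ioi le_rfl)]
  have e1 : ∫⁻ t in Ioc 0 T, (μ.restrict A) {x | ENNReal.ofReal t < g x ^ 2} ≤
      ENNReal.ofReal (m ^ N * T) := by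
    refine (lintegral_mono fun t => hb1 t).trans (le_of_eq ?_)
    rw [lintegral_const, Measure.restrict_apply_univ, Real.volume_Ioc, sub_zero,
      ← ENNReal.ofReal_mul (by positivity)]
  have e2 : ∫⁻ t in Ioi T, (μ.restrict A) {x | ENNReal.ofReal t < g x ^ 2} ≤
      ENNReal.ofReal (w ^ N * (-T ^ (-(N : ℝ) / 2 + 1) / (-(N : ℝ) / 2 + 1))) := by
    refine (setLIntegral_mono' measurableSet_Ioi fun t ht => hb2 t (hT0.trans ht)).trans ?_
    rw [← integral_Ioi_rpow_of_lt hexp hT0, ← integral_const_mul,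
      ofReal_integral_eq_lintegral_ofReal]
    · exact (integrableOn_Ioi_rpow_of_lt hexp hT0).const_mul _
    · filter_upwards [ae_restrict_mem measurableSet_Ioi] with t ht
      have : 0 < t := hT0.trans ht
      positivity
  have hTp : w ^ N * T ^ (-(N : ℝ) / 2 + 1) = w ^ 2 * m ^ (N - 2) := by
    have h1 : T ^ (-(N : ℝ) / 2 + 1) = (w / m) ^ (-((N - 2 : ℕ) : ℝ)) := by
      rw [hT, ← Real.rpow_natCast_mul (by positivity), Nat.cast_sub (by omega)]
      congr 1; push_cast; ring
    rw [h1, Real.rpow_neg (by positivity), Real.rpow_natCast, div_pow, inv_div]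
    have : w ^ N = w ^ 2 * w ^ (N - 2) := by rw [← pow_add]; congr 1; omega
    rw [this]; field_simp
  have hTm : m ^ N * T = w ^ 2 * m ^ (N - 2) := by
    have : m ^ N = m ^ 2 * m ^ (N - 2) := by rw [← pow_add]; congr 1; omega
    rw [this, hT]; field_simp
  refine (add_le_add e1 e2).trans (le_of_eq ?_)
  have hN2 : (0 : ℝ) < N - 2 := by linarith
  have hlast : w ^ N * (-T ^ (-(N : ℝ) / 2 + 1) / (-(N : ℝ) / 2 + 1)) =
      w ^ 2 * m ^ (N - 2) * (2 / (N - 2)) := by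
    rw [← hTp]
    have : -(N : ℝ) / 2 + 1 = -((N - 2) / 2) := by ring
    rw [this, neg_div_neg_eq]; field_simp
  rw [hlast, hTm, hroot, ← ENNReal.ofReal_add (by positivity) (by positivity),
    ← ENNReal.ofReal_mul (by positivity)]
  congr 1
  field_simp; ring

/-- `∫ g² f² ≤ 2N / (N - 2) w² ∫_0^∞ s |{f > s}|^{(N-2)/N} ds` for `g` in weak `L^N`. -/
theorem lintegral_sq_mul_sq_le_of_weak {α : Type*} [MeasurableSpace α] {μ : Measure α} [SFinite μ]
    {N : ℕ} (hN : 3 ≤ N) {g : α → ℝ≥0∞} (hg : Measurable g) {w : ℝ} (hw : 0 < w)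
    (h : ∀ t : ℝ, 0 < t → μ {x | ENNReal.ofReal t < g x} ≤ ENNReal.ofReal ((w / t) ^ N))
    {f : α → ℝ} (hf : Measurable f) (hf0 : ∀ x, 0 ≤ f x) (hff : ∀ s, 0 < s → μ {x | s < f x} ≠ ∞) :
    ∫⁻ x, g x ^ 2 * ENNReal.ofReal (f x) ^ 2 ∂μ ≤ ENNReal.ofReal (2 * N / (N - 2) * w ^ 2) *
      ∫⁻ s in Ioi (0 : ℝ), ENNReal.ofReal s * μ {x | s < f x} ^ (((N : ℝ) - 2) / N) := by
  have hN3 : (3 : ℝ) ≤ N := by exact_mod_cast hN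
  have hN2 : (0 : ℝ) < N - 2 := by linarith
  have hanti : Antitone fun s : ℝ => μ {x | s < f x} := fun s s' hss =>
    measure_mono fun x hx => lt_of_le_of_lt hss hx
  have hm := hanti.measurable
  calc ∫⁻ x, g x ^ 2 * ENNReal.ofReal (f x) ^ 2 ∂μ
      = ∫⁻ x, ENNReal.ofReal (f x ^ (2 : ℝ)) ∂(μ.withDensity fun x => g x ^ 2) := by
        rw [lintegral_withDensity_eq_lintegral_mul _ (by fun_prop) (by fun_prop)]
        refine lintegral_congr fun x => ?_
        simp [ENNReal.ofReal_pow (hf0 x)]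
    _ = ENNReal.ofReal 2 * ∫⁻ s in Ioi (0 : ℝ),
          (μ.withDensity fun x => g x ^ 2) {x | s < f x} * ENNReal.ofReal (s ^ ((2 : ℝ) - 1)) :=
        lintegral_rpow_eq_lintegral_meas_lt_mul _ (Eventually.of_forall hf0) hf.aemeasurable
          two_pos
    _ ≤ ENNReal.ofReal 2 * ∫⁻ s in Ioi (0 : ℝ), ENNReal.ofReal (N / (N - 2) * w ^ 2) *
          (ENNReal.ofReal s * μ {x | s < f x} ^ (((N : ℝ) - 2) / N)) := by
        gcongr 1
        refine setLIntegral_mono' measurableSet_Ioi fun s hs => ?_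
        have hs' : MeasurableSet {x | s < f x} := measurableSet_lt measurable_const hf
        rw [withDensity_apply _ hs']
        refine (mul_le_mul' (setLIntegral_sq_le_of_weak hN hg hw h (hff s hs)) le_rfl).trans
          (le_of_eq ?_)
        norm_num
        ring
    _ = _ := by
        have hm' : Measurable fun s : ℝ =>
            ENNReal.ofReal s * μ {x | s < f x} ^ (((N : ℝ) - 2) / N) :=
          ENNReal.measurable_ofReal.mul (hm.pow_const _)
        rw [lintegral_const_mul _ hm', ← mul_assoc,
          ← ENNReal.ofReal_mul two_pos.le]
        congr 2; ring

/-- Weighted form of the isoperimetric inequality for superlevel sets. -/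
theorem weighted_isoperimetric {N : ℕ} (hN : 2 ≤ N) {u : Space N → ℂ} (hu : ContDiff ℝ 1 u)
    (hc : HasCompactSupport u) {φ : ℝ → ℝ≥0∞} (hφ : Monotone φ) (hφ0 : φ 0 = 0) :
    N * volume (Metric.ball (0 : Space N) 1) ^ (1 / (N : ℝ)) *
      ∫⁻ s in Ioi (0 : ℝ), φ s * volume {x | s < ‖u x‖} ^ (((N : ℝ) - 1) / N) ≤
      ∫⁻ x, φ ‖u x‖ * ‖fderiv ℝ u x‖ₑ := by
  have hfm : Measurable fun x => ‖u x‖ := hu.continuous.norm.measurable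
  have hDm : Measurable fun x => ‖fderiv ℝ u x‖ₑ := (hu.continuous_fderiv one_ne_zero).enorm.measurable
  have hφm : Measurable φ := hφ.measurable
  have hφf : Measurable fun x => φ ‖u x‖ := hφm.comp hfm
  have hanti : Antitone fun s : ℝ => volume {x | s < ‖u x‖} := fun s s' hss =>
    measure_mono fun x hx => lt_of_le_of_lt hss hx
  have hm := hanti.measurable
  set C := N * volume (Metric.ball (0 : Space N) 1) ^ (1 / (N : ℝ)) with hC
  -- The isoperimetric inequality reads `ρ [r, ∞) ≤ ν {|u| ≥ r}` for `r > 0`. Superlevel sets of the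
  -- monotone `φ` are upper sets, and `φ 0 = 0` keeps them inside `(0, ∞)`.
  set ρ := (volume.restrict (Ioi (0 : ℝ))).withDensity
    fun s => C * volume {x | s < ‖u x‖} ^ (((N : ℝ) - 1) / N) with hρ
  set ν := ((volume : Measure (Space N)).withDensity fun x => ‖fderiv ℝ u x‖ₑ) with hν
  have h1 : C * ∫⁻ s in Ioi (0 : ℝ), φ s * volume {x | s < ‖u x‖} ^ (((N : ℝ) - 1) / N) =
      ∫⁻ s, φ s ∂ρ := by
    rw [hρ, lintegral_withDensity_eq_lintegral_mul _ (by fun_prop) hφm,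
      ← lintegral_const_mul _ (by fun_prop)]
    refine lintegral_congr fun s => ?_
    simp only [Pi.mul_apply]; ring
  have h2 : ∫⁻ x, φ ‖u x‖ * ‖fderiv ℝ u x‖ₑ = ∫⁻ x, φ ‖u x‖ ∂ν := by
    rw [hν, lintegral_withDensity_eq_lintegral_mul _ hDm hφf]
    refine lintegral_congr fun s => ?_
    simp only [Pi.mul_apply]; ring
  rw [h1, h2, lintegral_layer_cake ρ hφm, lintegral_layer_cake ν hφf]
  refine setLIntegral_mono' measurableSet_Ioi fun t ht => ?_
  have hU : IsUpperSet {s | ENNReal.ofReal t < φ s} := fun s s' hss hs =>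
    lt_of_lt_of_le hs (hφ hss)
  refine measure_le_of_isUpperSet hU ρ fun r hr => ?_
  have hr0 : 0 < r := by
    by_contra hcon
    have : φ r ≤ 0 := hφ0 ▸ hφ (not_lt.1 hcon)
    exact absurd (lt_of_lt_of_le hr this) not_lt_zero
  calc ρ (Ici r) = C * ∫⁻ s in Ioi r, volume {x | s < ‖u x‖} ^ (((N : ℝ) - 1) / N) := by
        rw [hρ, withDensity_apply _ measurableSet_Ici, Measure.restrict_restrict measurableSet_Ici,
          inter_eq_left.2 (Ici_subset_Ioi.2 hr0), ← lintegral_const_mul _ (by fun_prop)]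
        exact setLIntegral_congr Ioi_ae_eq_Ici.symm
    _ ≤ ∫⁻ x in {x | r ≤ ‖u x‖}, ‖fderiv ℝ u x‖ₑ := isoperimetric_superlevel hN hu hc hr0.le
    _ = ν {x | r ≤ ‖u x‖} := by
        rw [hν, withDensity_apply _ (measurableSet_le measurable_const hfm)]
    _ ≤ _ := measure_mono fun x hx => hU hx hr

/-- Boundedness and compact support of `u` give a bounded integrand that vanishes for large `s`. The
finiteness permits cancelling this integral in `lintegral_superlevel_le`. -/
theorem lintegral_superlevel_lt_top {N : ℕ} (hN : 3 ≤ N) {u : Space N → ℂ} (hu : Continuous u)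
    (hc : HasCompactSupport u) :
    ∫⁻ s in Ioi (0 : ℝ), ENNReal.ofReal s * volume {x | s < ‖u x‖} ^ (((N : ℝ) - 2) / N) < ∞ := by
  have hN3 : (3 : ℝ) ≤ N := by exact_mod_cast hN
  have hexp : 0 < ((N : ℝ) - 2) / N := div_pos (by linarith) (by linarith)
  obtain ⟨M, hM⟩ := hc.exists_bound_of_continuous hu
  have hM0 : 0 ≤ M := (norm_nonneg _).trans (hM 0)
  set V := volume (tsupport u) with hV
  have hVt : V ≠ ∞ := hc.isCompact.measure_lt_top.ne
  have hle : ∀ s ∈ Ioi (0 : ℝ), ENNReal.ofReal s *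
      volume {x | s < ‖u x‖} ^ (((N : ℝ) - 2) / N) ≤
      (Iio M).indicator (fun _ => ENNReal.ofReal M * V ^ (((N : ℝ) - 2) / N)) s := by
    intro s hs
    by_cases hsM : s < M
    · rw [indicator_of_mem (show s ∈ Iio M from hsM)]
      gcongr ENNReal.ofReal ?_ * ?_ ^ _
      refine measure_mono fun x hx => subset_tsupport _ fun h0 => ?_
      simp only [mem_ofPred_eq, h0, norm_zero] at hx
      exact absurd hx (not_lt.2 (le_of_lt hs))
    · have : {x | s < ‖u x‖} = ∅ := eq_empty_of_forall_notMem fun x hx =>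
        absurd (lt_of_lt_of_le hx (hM x)) hsM
      simp [this, hexp]
  refine lt_of_le_of_lt (setLIntegral_mono' measurableSet_Ioi hle) ?_
  rw [lintegral_indicator_const measurableSet_Iio, Measure.restrict_apply measurableSet_Iio,
    inter_comm, Ioi_inter_Iio, Real.volume_Ioo]
  exact ENNReal.mul_lt_top (ENNReal.mul_lt_top ENNReal.ofReal_lt_top
    (ENNReal.rpow_lt_top_of_nonneg hexp.le hVt)) ENNReal.ofReal_lt_top

theorem rpow_neg_anti {p : ℝ} (hp : 0 < p) {x y : ℝ≥0∞} (h : x ≤ y) :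
    y ^ (-(1 / p)) ≤ x ^ (-(1 / p)) := by
  rw [ENNReal.rpow_neg, ENNReal.rpow_neg, ENNReal.inv_le_inv]
  exact ENNReal.rpow_le_rpow h (by positivity)

/-- `(N ω_N^{1/N})² ∫_0^∞ s |{|u| > s}|^{(N-2)/N} ds ≤ 2N / (N - 2) ∫ |Du|²`. -/
theorem lintegral_superlevel_le {N : ℕ} (hN : 3 ≤ N) {u : Space N → ℂ} (hu : ContDiff ℝ 1 u)
    (hc : HasCompactSupport u) :
    (N * volume (Metric.ball (0 : Space N) 1) ^ (1 / (N : ℝ))) ^ 2 *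
      ∫⁻ s in Ioi (0 : ℝ), ENNReal.ofReal s * volume {x | s < ‖u x‖} ^ (((N : ℝ) - 2) / N) ≤
      ENNReal.ofReal (2 * N / (N - 2)) * ∫⁻ x, ‖fderiv ℝ u x‖ₑ ^ 2 := by
  have hN3 : (3 : ℝ) ≤ N := by exact_mod_cast hN
  have hN0 : (0 : ℝ) < N := by linarith
  have hXt := lintegral_superlevel_lt_top hN hu.continuous hc
  set C := N * volume (Metric.ball (0 : Space N) 1) ^ (1 / (N : ℝ)) with hC
  set X := ∫⁻ s in Ioi (0 : ℝ), ENNReal.ofReal s *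
    volume {x | s < ‖u x‖} ^ (((N : ℝ) - 2) / N) with hX
  have hfm : Measurable fun x => ‖u x‖ := hu.continuous.norm.measurable
  have hDm : Measurable fun x => ‖fderiv ℝ u x‖ₑ := (hu.continuous_fderiv one_ne_zero).enorm.measurable
  have hfin : ∀ s, 0 < s → volume {x | s < ‖u x‖} ≠ ∞ := fun s hs => by
    refine measure_ne_top_of_subset (fun x hx => subset_tsupport u ?_)
      hc.isCompact.measure_lt_top.ne
    intro h0
    simp only [mem_ofPred_eq, h0, norm_zero] at hx
    exact absurd hx (not_lt.2 hs.le)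
  -- This weight lowers the exponent `(N-1)/N` to `(N-2)/N`, and `ψ(|u|)` has weak `L^N` norm at
  -- most `1` (`hweak`), so `X` reappears on the right.
  set ψ : ℝ → ℝ≥0∞ := fun s => volume {y | s ≤ ‖u y‖} ^ (-(1 / (N : ℝ))) with hψ
  have hψmono : Monotone ψ := fun s s' hss => by
    exact rpow_neg_anti hN0 (measure_mono fun y hy => le_trans hss hy)
  have hψm : Measurable ψ := hψmono.measurable
  have hφmono : Monotone fun s : ℝ => ENNReal.ofReal s * ψ s := fun s s' hss =>
    mul_le_mul' (ENNReal.ofReal_le_ofReal hss) (hψmono hss)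
  have hweak : ∀ t : ℝ, 0 < t → volume {x | ENNReal.ofReal t < ψ ‖u x‖} ≤
      ENNReal.ofReal ((1 / t) ^ N) := by
    intro t ht
    refine le_trans (measure_mono fun x hx => ?_)
      (measure_measure_superlevel_lt volume hfm (ENNReal.ofReal ((1 / t) ^ N)))
    by_contra hcon
    have h1 : ENNReal.ofReal ((1 / t) ^ N) ≤ volume {y | ‖u x‖ ≤ ‖u y‖} := not_lt.1 hcon
    have h2 : ψ ‖u x‖ ≤ ENNReal.ofReal t := by
      calc ψ ‖u x‖ ≤ ENNReal.ofReal ((1 / t) ^ N) ^ (-(1 / (N : ℝ))) :=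
            rpow_neg_anti hN0 h1
        _ = ENNReal.ofReal t := by
            rw [ENNReal.ofReal_rpow_of_pos (by positivity),
              ← Real.rpow_natCast_mul (by positivity), mul_neg, mul_one_div_cancel hN0.ne',
              Real.rpow_neg_one]
            simp
    exact absurd hx (not_lt.2 h2)
  have hG := lintegral_sq_mul_sq_le_of_weak hN (g := fun x => ψ ‖u x‖) (hψm.comp hfm) one_pos
    hweak hfm (fun x => norm_nonneg _) hfin
  rw [one_pow, mul_one, ← hX] at hG
  have hI := weighted_isoperimetric (by omega) hu hc hφmono (by simp)
  have hXeq : ∫⁻ s in Ioi (0 : ℝ), ENNReal.ofReal s * ψ s *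
      volume {x | s < ‖u x‖} ^ (((N : ℝ) - 1) / N) = X := by
    refine setLIntegral_congr_fun_ae measurableSet_Ioi ?_
    -- `{|u| ≥ s}` and `{|u| > s}` have equal measure for almost every `s`. Measure zero is a
    -- separate case: there `ψ = ∞`, and the product is `∞ * 0 = 0`.
    filter_upwards [meas_le_ae_eq_meas_lt volume volume fun x => ‖u x‖] with s hs hs0
    have h0 := hfin s hs0
    simp only [hψ]
    rw [hs, mul_assoc]
    congr 1
    by_cases hz : volume {x | s < ‖u x‖} = 0
    · have h1 : 0 < ((N : ℝ) - 1) / N := div_pos (by linarith) hN0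
      have h2 : 0 < ((N : ℝ) - 2) / N := div_pos (by linarith) hN0
      rw [hz, ENNReal.zero_rpow_of_pos h1, ENNReal.zero_rpow_of_pos h2, mul_zero]
    · rw [← ENNReal.rpow_add _ _ hz h0]
      congr 1; field_simp; ring
  rw [hXeq] at hI
  have hCS : ∫⁻ x, ENNReal.ofReal ‖u x‖ * ψ ‖u x‖ * ‖fderiv ℝ u x‖ₑ ≤
      (∫⁻ x, ψ ‖u x‖ ^ 2 * ENNReal.ofReal ‖u x‖ ^ 2) ^ (1 / (2 : ℝ)) *
        (∫⁻ x, ‖fderiv ℝ u x‖ₑ ^ 2) ^ (1 / (2 : ℝ)) := by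
    have h := ENNReal.lintegral_mul_le_Lp_mul_Lq volume Real.HolderConjugate.two_two
      (f := fun x => ENNReal.ofReal ‖u x‖ * ψ ‖u x‖) (g := fun x => ‖fderiv ℝ u x‖ₑ)
      (by fun_prop) hDm.aemeasurable
    simp only [Pi.mul_apply, ENNReal.rpow_two, mul_pow] at h
    simpa only [mul_comm (ψ _ ^ 2)] using h
  have hsq : (C * X) ^ 2 ≤ ENNReal.ofReal (2 * N / (N - 2)) * X * ∫⁻ x, ‖fderiv ℝ u x‖ₑ ^ 2 := by
    calc (C * X) ^ 2 ≤ ((∫⁻ x, ψ ‖u x‖ ^ 2 * ENNReal.ofReal ‖u x‖ ^ 2) ^ (1 / (2 : ℝ)) *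
        (∫⁻ x, ‖fderiv ℝ u x‖ₑ ^ 2) ^ (1 / (2 : ℝ))) ^ 2 := by
          exact pow_le_pow_left' (hI.trans hCS) 2
      _ = (∫⁻ x, ψ ‖u x‖ ^ 2 * ENNReal.ofReal ‖u x‖ ^ 2) * ∫⁻ x, ‖fderiv ℝ u x‖ₑ ^ 2 := by
          rw [mul_pow, ← ENNReal.rpow_mul_natCast, ← ENNReal.rpow_mul_natCast]
          norm_num
      _ ≤ _ := by gcongr
  by_cases hX0 : X = 0
  · simp [hX0]
  have : X * (C ^ 2 * X) ≤ X * (ENNReal.ofReal (2 * N / (N - 2)) * ∫⁻ x, ‖fderiv ℝ u x‖ₑ ^ 2) := by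
    calc X * (C ^ 2 * X) = (C * X) ^ 2 := by ring
      _ ≤ _ := hsq
      _ = _ := by ring
  exact (ENNReal.mul_le_mul_iff_right hX0 hXt.ne).1 this

theorem sobolevConst_two {N : ℕ} (hN : 3 ≤ N) :
    sobolevConst N 2 =
      (volume (Metric.ball (0 : Space N) 1) ^ (1 / (N : ℝ)))⁻¹ * ENNReal.ofReal (2 / (N - 2)) := by
  have hN3 : (3 : ℝ) ≤ N := by exact_mod_cast hN
  rw [sobolevConst, ENNReal.rpow_neg, ENNReal.ofReal_div_of_pos (by linarith),
    ENNReal.ofReal_sub _ (by norm_num)]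
  simp

/-- The Hardy–Lorentz inequality `‖g u‖₂ ≤ S_{N,2} ‖g‖_{N,∞} ‖Du‖₂` with the sharp constant. -/
theorem hardy_lorentz {N : ℕ} (hN : 3 ≤ N) {u : Space N → ℂ} (hu : ContDiff ℝ 1 u)
    (hc : HasCompactSupport u) (Ω : Set (Space N)) {g : Space N → ℝ≥0∞} (hg : Measurable g)
    {w : ℝ} (hw : 0 < w)
    (h : ∀ t : ℝ, 0 < t →
      volume.restrict Ω {x | ENNReal.ofReal t < g x} ≤ ENNReal.ofReal ((w / t) ^ N)) :
    ∫⁻ x in Ω, g x ^ 2 * ‖u x‖ₑ ^ 2 ≤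
      (sobolevConst N 2 * ENNReal.ofReal w) ^ 2 * ∫⁻ x, ‖fderiv ℝ u x‖ₑ ^ 2 := by
  have hN3 : (3 : ℝ) ≤ N := by exact_mod_cast hN
  have hN2 : (0 : ℝ) < N - 2 := by linarith
  have hfm : Measurable fun x => ‖u x‖ := hu.continuous.norm.measurable
  have hfin : ∀ s, 0 < s → volume {x | s < ‖u x‖} ≠ ∞ := fun s hs => by
    refine measure_ne_top_of_subset (fun x hx => subset_tsupport u ?_)
      hc.isCompact.measure_lt_top.ne
    intro h0
    simp only [mem_ofPred_eq, h0, norm_zero] at hx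
    exact absurd hx (not_lt.2 hs.le)
  have h1 := lintegral_sq_mul_sq_le_of_weak hN hg hw h hfm (fun x => norm_nonneg _)
    (fun s hs => ne_top_of_le_ne_top (hfin s hs) (Measure.restrict_apply_le _ _))
  simp only [ofReal_norm] at h1
  have h2 := lintegral_superlevel_le hN hu hc
  have hω0 : volume (Metric.ball (0 : Space N) 1) ≠ 0 :=
    (Metric.measure_ball_pos _ _ one_pos).ne'
  have hωt : volume (Metric.ball (0 : Space N) 1) ≠ ∞ := measure_ball_lt_top.ne
  rw [sobolevConst_two hN]
  set κ := volume (Metric.ball (0 : Space N) 1) ^ (1 / (N : ℝ)) with hκ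
  have hκ0 : κ ≠ 0 := by simp [hκ, hω0, hωt]
  have hκt : κ ≠ ∞ := ENNReal.rpow_ne_top_of_nonneg (by positivity) hωt
  set X := ∫⁻ s in Ioi (0 : ℝ), ENNReal.ofReal s *
    volume {x | s < ‖u x‖} ^ (((N : ℝ) - 2) / N) with hX
  set E := ∫⁻ x, ‖fderiv ℝ u x‖ₑ ^ 2 with hE
  have h3 : X ≤ (κ⁻¹) ^ 2 * ENNReal.ofReal (2 / (N * (N - 2))) * E := by
    have hNk0 : ((N : ℝ≥0∞) * κ) ^ 2 ≠ 0 := by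
      simp [hκ0]; omega
    have hNkt : ((N : ℝ≥0∞) * κ) ^ 2 ≠ ∞ := by
      simp [ENNReal.mul_eq_top, hκt]
    rw [← ENNReal.mul_le_mul_iff_right hNk0 hNkt]
    refine h2.trans (le_of_eq ?_)
    calc ENNReal.ofReal (2 * N / (N - 2)) * E
        = (κ * κ⁻¹) ^ 2 * (ENNReal.ofReal (N ^ 2) * ENNReal.ofReal (2 / (N * (N - 2)))) * E := by
          rw [ENNReal.mul_inv_cancel hκ0 hκt, one_pow, one_mul, ← ENNReal.ofReal_mul (by positivity)]
          congr 2; field_simp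
      _ = _ := by
          rw [ENNReal.ofReal_pow (by positivity), ENNReal.ofReal_natCast]; ring
  -- The constants multiply to `2N/(N-2) · 2/(N(N-2)) = (2/(N-2))²`, which with `κ⁻²` is exactly
  -- `S_{N,2}²`.
  calc ∫⁻ x in Ω, g x ^ 2 * ‖u x‖ₑ ^ 2
      ≤ ENNReal.ofReal (2 * N / (N - 2) * w ^ 2) * X := by
        refine h1.trans ?_
        refine mul_le_mul' le_rfl (lintegral_mono fun s => mul_le_mul' le_rfl
          (ENNReal.rpow_le_rpow (Measure.restrict_apply_le _ _) (by positivity)))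
    _ ≤ ENNReal.ofReal (2 * N / (N - 2) * w ^ 2) *
        ((κ⁻¹) ^ 2 * ENNReal.ofReal (2 / (N * (N - 2))) * E) := by gcongr
    _ = (κ⁻¹) ^ 2 * (ENNReal.ofReal (2 * N / (N - 2) * w ^ 2) *
        ENNReal.ofReal (2 / (N * (N - 2)))) * E := by ring
    _ = _ := by
        rw [← ENNReal.ofReal_mul (by positivity), mul_pow, mul_pow,
          ← ENNReal.ofReal_pow (by positivity), ← ENNReal.ofReal_pow (by positivity),
          mul_assoc ((κ⁻¹) ^ 2) _ (ENNReal.ofReal (w ^ 2)), ← ENNReal.ofReal_mul (by positivity)]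
        congr 3; field_simp

end ConvDiff

namespace ConvDiff

open Set

/-! ### Ellipticity of the form under a relative bound for the convective field -/

theorem eLpNorm_two_sq {α F : Type*} [MeasurableSpace α] [NormedAddCommGroup F] {μ : Measure α}
    (f : α → F) : eLpNorm f 2 μ ^ 2 = ∫⁻ x, ‖f x‖ₑ ^ 2 ∂μ := by
  have := eLpNorm_nnreal_pow_eq_lintegral (μ := μ) (f := f) (p := 2) two_ne_zero
  simpa using this

theorem integrable_norm_sq_Lp {α : Type*} [MeasurableSpace α] {μ : Measure α} (f : Lp ℂ 2 μ) :
    Integrable (fun x => ‖f x‖ ^ 2) μ :=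
  (memLp_two_iff_integrable_sq_norm (Lp.aestronglyMeasurable f)).1 (Lp.memLp f)

theorem integral_norm_sq_Lp {α : Type*} [MeasurableSpace α] {μ : Measure α} (f : Lp ℂ 2 μ) :
    ∫ x, ‖f x‖ ^ 2 ∂μ = ‖f‖ ^ 2 := by
  rw [integral_eq_lintegral_of_nonneg_ae (Eventually.of_forall fun x => by positivity)
    (integrable_norm_sq_Lp f).aestronglyMeasurable, Lp.norm_def, ← ENNReal.toReal_pow, eLpNorm_two_sq]
  congr 1
  refine lintegral_congr fun x => ?_
  rw [ENNReal.ofReal_pow (norm_nonneg _), ofReal_norm]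

/-- The pointwise lower bound for the integrand on the diagonal. -/
theorem re_integrand_ge {N : ℕ} {a : Matrix (Fin N) (Fin N) ℝ} {η A B : ℝ} (hη : 0 < η)
    (ha : ∀ σ : Space N, η * ‖σ‖ ^ 2 ≤ ∑ i, ∑ j, a i j * σ i * σ j)
    {α : Fin N → ℝ} (hα : ∀ j, |α j| ≤ A) {β : ℝ} (hβ : |β| ≤ B) (b : Fin N → ℝ)
    (ξ : Fin N → ℂ) (z : ℂ) :
    η / 2 * (∑ i, ‖ξ i‖ ^ 2) - (N * (A ^ 2 / η) + B) * ‖z‖ ^ 2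
        - 1 / η * ((∑ j, b j ^ 2) * ‖z‖ ^ 2) ≤
      ((∑ i, ∑ j, (a i j : ℂ) * ξ i * conj (ξ j))
        + (∑ j, ((α j : ℂ) * ξ j * conj z + (b j : ℂ) * z * conj (ξ j)))
        + (β : ℂ) * z * conj z).re := by
  -- As `a` is real, the mixed products of real and imaginary parts drop out of the real part, and
  -- ellipticity applies to `Re ξ` and `Im ξ` separately.
  have h1 : η * ∑ i, ‖ξ i‖ ^ 2 ≤ (∑ i, ∑ j, (a i j : ℂ) * ξ i * conj (ξ j)).re := by
    have hr := ha (WithLp.toLp 2 fun i => (ξ i).re)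
    have hi := ha (WithLp.toLp 2 fun i => (ξ i).im)
    rw [EuclideanSpace.real_norm_sq_eq] at hr hi
    have e1 : ∑ i, ‖ξ i‖ ^ 2 = ∑ i, (ξ i).re ^ 2 + ∑ i, (ξ i).im ^ 2 := by
      rw [← Finset.sum_add_distrib]
      refine Finset.sum_congr rfl fun i _ => ?_
      rw [Complex.sq_norm, Complex.normSq_apply]; ring
    have e2 : (∑ i, ∑ j, (a i j : ℂ) * ξ i * conj (ξ j)).re =
        ∑ i, ∑ j, a i j * (ξ i).re * (ξ j).re + ∑ i, ∑ j, a i j * (ξ i).im * (ξ j).im := by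
      simp only [Complex.re_sum, ← Finset.sum_add_distrib]
      refine Finset.sum_congr rfl fun i _ => Finset.sum_congr rfl fun j _ => ?_
      simp
    rw [e1, e2, mul_add]
    exact add_le_add hr hi
  -- Used once for `α` and once for `b`, this leaves `η/2` of the ellipticity constant.
  have young : ∀ s x y : ℝ, -(η / 4 * x ^ 2 + 1 / η * s ^ 2 * y ^ 2) ≤ -(|s| * x * y) := by
    intro s x y
    have h : η / 4 * x ^ 2 + 1 / η * s ^ 2 * y ^ 2 - |s| * x * y =
        1 / η * (η / 2 * x - |s| * y) ^ 2 := by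
      rw [← sq_abs s]; field_simp; ring
    have : 0 ≤ 1 / η * (η / 2 * x - |s| * y) ^ 2 := by positivity
    linarith
  have h2 : ∀ j, -(η / 2 * ‖ξ j‖ ^ 2 + A ^ 2 / η * ‖z‖ ^ 2 + 1 / η * b j ^ 2 * ‖z‖ ^ 2) ≤
      ((α j : ℂ) * ξ j * conj z + (b j : ℂ) * z * conj (ξ j)).re := by
    intro j
    have i1 : -(|α j| * ‖ξ j‖ * ‖z‖) ≤ ((α j : ℂ) * ξ j * conj z).re := by
      have := (abs_le.1 (Complex.abs_re_le_norm ((α j : ℂ) * ξ j * conj z))).1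
      simpa using this
    have i2 : -(|b j| * ‖ξ j‖ * ‖z‖) ≤ ((b j : ℂ) * z * conj (ξ j)).re := by
      have := (abs_le.1 (Complex.abs_re_le_norm ((b j : ℂ) * z * conj (ξ j)))).1
      have e : |b j| * ‖ξ j‖ * ‖z‖ = |b j| * ‖z‖ * ‖ξ j‖ := by ring
      rw [e]
      simpa using this
    have y1 := young (α j) ‖ξ j‖ ‖z‖
    have y2 := young (b j) ‖ξ j‖ ‖z‖
    have i3 : 1 / η * α j ^ 2 * ‖z‖ ^ 2 ≤ A ^ 2 / η * ‖z‖ ^ 2 := by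
      rw [div_mul_eq_mul_div, one_mul]
      have := sq_le_sq' (abs_le.1 (hα j)).1 (abs_le.1 (hα j)).2
      gcongr
    rw [Complex.add_re]
    linarith
  have h3 := Finset.sum_le_sum fun j (_ : j ∈ Finset.univ) => h2 j
  simp only [Finset.sum_neg_distrib, Finset.sum_add_distrib, Finset.sum_const, Finset.card_univ,
    Fintype.card_fin, nsmul_eq_mul, ← Finset.mul_sum, ← Finset.sum_mul] at h3
  have h4 : -(B * ‖z‖ ^ 2) ≤ ((β : ℂ) * z * conj z).re := by
    rw [mul_assoc, Complex.mul_conj, ← Complex.ofReal_mul, Complex.ofReal_re, ← Complex.sq_norm,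
      ← neg_mul]
    have := (abs_le.1 hβ).1
    gcongr
  rw [Complex.add_re, Complex.add_re, Complex.re_sum]
  have e5 : η / 2 * (∑ i, ‖ξ i‖ ^ 2) - (N * (A ^ 2 / η) + B) * ‖z‖ ^ 2
      - 1 / η * ((∑ j, b j ^ 2) * ‖z‖ ^ 2) = η * ∑ i, ‖ξ i‖ ^ 2
      + -(η / 2 * (∑ i, ‖ξ i‖ ^ 2) + N * (A ^ 2 / η * ‖z‖ ^ 2)
        + 1 / η * (∑ j, b j ^ 2) * ‖z‖ ^ 2) + -(B * ‖z‖ ^ 2) := by ring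
  rw [e5, ← Complex.re_sum]
  refine add_le_add (add_le_add h1 (h3.trans_eq ?_)) h4
  rw [Complex.re_sum]

theorem exists_bound_of_memLp_top {α : Type*} [MeasurableSpace α] {μ : Measure α} {f : α → ℝ}
    (hf : MemLp f ∞ μ) : ∃ C : ℝ, 0 ≤ C ∧ ∀ᵐ x ∂μ, |f x| ≤ C := by
  refine ⟨(eLpNorm f ∞ μ).toReal, ENNReal.toReal_nonneg, ?_⟩
  rw [eLpNorm_exponent_top]
  filter_upwards [ae_le_eLpNormEssSup (f := f) (μ := μ)] with x hx
  have hlt : eLpNormEssSup f μ ≠ ∞ := by simpa using hf.2.ne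
  rw [← Real.norm_eq_abs, ← toReal_enorm]
  exact ENNReal.toReal_mono hlt hx

/-- If `∫ |b|² |u|² ≤ (η² / 4) ‖∇u‖² + M ‖u‖²` on `V`, then the form is well defined and
`L²(Ω)`-elliptic on `V`. -/
theorem wellDefined_and_elliptic_of_bound {N : ℕ} {Ω : Set (Space N)} (hΩ : MeasurableSet Ω)
    {D : Coeffs N} {η : ℝ} (hD : D.IsStronglyElliptic Ω η) {b : Space N → Fin N → ℝ}
    (hb : ∀ j, AEStronglyMeasurable (fun x => b x j) (volume.restrict Ω)) {V : Set (H1 Ω)} {M : ℝ}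
    (hM : 0 ≤ M) (H : ∀ u ∈ V, ∫⁻ x in Ω, ENNReal.ofReal ((∑ j, b x j ^ 2) * ‖u.val x‖ ^ 2) ≤
      ENNReal.ofReal (η ^ 2 / 4 * (∑ i, ‖u.grad i‖ ^ 2) + M * ‖u.val‖ ^ 2)) :
    IsWellDefinedOn D b V ∧ IsL2Elliptic V (form D b) := by
  have hη := hD.pos
  have hQm : ∀ u : H1 Ω, AEStronglyMeasurable
      (fun x => (∑ j, b x j ^ 2) * ‖u.val x‖ ^ 2) (volume.restrict Ω) := fun u =>
    (Finset.aestronglyMeasurable_fun_sum _ fun j _ => (hb j).pow 2).mul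
      ((Lp.aestronglyMeasurable u.val).norm.pow 2)
  have hQ0 : ∀ (u : H1 Ω) x, 0 ≤ (∑ j, b x j ^ 2) * ‖u.val x‖ ^ 2 := fun u x => by positivity
  have hQi : ∀ u ∈ V, Integrable (fun x => (∑ j, b x j ^ 2) * ‖u.val x‖ ^ 2)
      (volume.restrict Ω) := by
    intro u hu
    refine ⟨hQm u, ?_⟩
    rw [hasFiniteIntegral_iff_ofReal (Eventually.of_forall (hQ0 u))]
    exact (H u hu).trans_lt ENNReal.ofReal_lt_top
  have hQle : ∀ u ∈ V, ∫ x in Ω, (∑ j, b x j ^ 2) * ‖u.val x‖ ^ 2 ≤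
      η ^ 2 / 4 * (∑ i, ‖u.grad i‖ ^ 2) + M * ‖u.val‖ ^ 2 := by
    intro u hu
    rw [integral_eq_lintegral_of_nonneg_ae (Eventually.of_forall (hQ0 u)) (hQm u)]
    exact ENNReal.toReal_le_of_le_ofReal (by positivity) (H u hu)
  have hbu : ∀ u ∈ V, ∀ j, MemLp (fun x => (b x j : ℂ) * u.val x) 2 (volume.restrict Ω) := by
    intro u hu j
    have hm : AEStronglyMeasurable (fun x => (b x j : ℂ) * u.val x) (volume.restrict Ω) :=
      (Complex.continuous_ofReal.comp_aestronglyMeasurable (hb j)).mul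
        (Lp.aestronglyMeasurable u.val)
    rw [memLp_two_iff_integrable_sq_norm hm]
    refine (hQi u hu).mono' (hm.norm.pow 2) (Eventually.of_forall fun x => ?_)
    rw [Real.norm_of_nonneg (by positivity), norm_mul, mul_pow, Complex.norm_real,
      Real.norm_eq_abs, sq_abs]
    gcongr
    exact Finset.single_le_sum (f := fun j => b x j ^ 2) (fun i _ => sq_nonneg _)
      (Finset.mem_univ j)
  have hprod : ∀ {f g : Space N → ℂ}, MemLp f 2 (volume.restrict Ω) →
      MemLp g 2 (volume.restrict Ω) → IntegrableOn (fun x => f x * conj (g x)) Ω :=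
    fun hf hg => hf.integrable_mul hg.star
  have hreal : ∀ {m : Space N → ℝ} (f : Lp ℂ 2 (volume.restrict Ω)),
      MemLp m ∞ (volume.restrict Ω) → MemLp (fun x => (m x : ℂ) * f x) 2 (volume.restrict Ω) :=
    fun f hm => (Lp.memLp f).mul' hm.ofReal
  have hwd : IsWellDefinedOn D b V := by
    intro u hu v _
    refine Integrable.add (Integrable.add ?_ ?_) ?_
    · exact integrable_finsetSum _ fun i _ => integrable_finsetSum _ fun j _ =>
        hprod (hreal _ (hD.bdd_a i j)) (Lp.memLp _)
    · exact integrable_finsetSum _ fun j _ => Integrable.add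
        (hprod (hreal _ (hD.bdd_α j)) (Lp.memLp _)) (hprod (hbu u hu j) (Lp.memLp _))
    · exact hprod (hreal _ hD.bdd_β) (Lp.memLp _)
  refine ⟨hwd, ?_⟩
  choose A hA0 hA using fun j => exists_bound_of_memLp_top (hD.bdd_α j)
  obtain ⟨B, _, hB⟩ := exists_bound_of_memLp_top hD.bdd_β
  set A' := ∑ j, A j with hA'
  have hA'0 : 0 ≤ A' := Finset.sum_nonneg fun j _ => hA0 j
  set K := N * (A' ^ 2 / η) + B with hK
  -- The bound `H`, divided by `η`, takes `η/4` from the remaining `η/2`. The summand `η/4` in `ω`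
  -- pays for the `L²` part of the `H¹` norm.
  refine ⟨K + M / η + η / 4, η / 4, by positivity, fun u hu => ?_⟩
  set G := ∑ i, ‖u.grad i‖ ^ 2 with hG
  have hGi : ∀ i, Integrable (fun x => ‖u.grad i x‖ ^ 2) (volume.restrict Ω) := fun i =>
    integrable_norm_sq_Lp _
  have hpt : ∀ᵐ x ∂(volume.restrict Ω), η / 2 * (∑ i, ‖u.grad i x‖ ^ 2) - K * ‖u.val x‖ ^ 2
      - 1 / η * ((∑ j, b x j ^ 2) * ‖u.val x‖ ^ 2) ≤ (formIntegrand D b u u x).re := by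
    filter_upwards [ae_restrict_mem hΩ, ae_all_iff.2 hA, hB] with x hx hAx hBx
    exact re_integrand_ge hη (hD.elliptic x hx) (fun j => (hAx j).trans
      (Finset.single_le_sum (fun j _ => hA0 j) (Finset.mem_univ j))) hBx (b x)
      (fun i => u.grad i x) (u.val x)
  have hi1 : Integrable (fun x => η / 2 * ∑ i, ‖u.grad i x‖ ^ 2) (volume.restrict Ω) :=
    (integrable_finsetSum _ fun i _ => hGi i).const_mul _
  have hi2 : Integrable (fun x => K * ‖u.val x‖ ^ 2) (volume.restrict Ω) :=
    (integrable_norm_sq_Lp _).const_mul _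
  have hi3 := (hQi u hu).const_mul (1 / η)
  have hint := integral_mono_ae ((hi1.sub hi2).sub hi3) (hwd u hu u hu).re hpt
  have hre : ∫ x in Ω, (formIntegrand D b u u x).re = (form D b u u).re :=
    integral_re (hwd u hu u hu)
  change _ ≤ ∫ x in Ω, (formIntegrand D b u u x).re at hint
  rw [hre] at hint
  have hl : ∫ x in Ω, (η / 2 * (∑ i, ‖u.grad i x‖ ^ 2) - K * ‖u.val x‖ ^ 2
      - 1 / η * ((∑ j, b x j ^ 2) * ‖u.val x‖ ^ 2)) =
      η / 2 * G - K * ‖u.val‖ ^ 2 - 1 / η * ∫ x in Ω, (∑ j, b x j ^ 2) * ‖u.val x‖ ^ 2 := by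
    rw [integral_sub (f := fun x => η / 2 * (∑ i, ‖u.grad i x‖ ^ 2) - K * ‖u.val x‖ ^ 2)
      (hi1.sub hi2) hi3, integral_sub hi1 hi2, integral_const_mul,
      integral_const_mul, integral_const_mul, integral_finsetSum _ fun i _ => hGi i,
      integral_norm_sq_Lp]
    simp only [integral_norm_sq_Lp, hG]
  have hint' : η / 2 * G - K * ‖u.val‖ ^ 2 -
      1 / η * ∫ x in Ω, (∑ j, b x j ^ 2) * ‖u.val x‖ ^ 2 ≤ (form D b u u).re := by
    rw [← hl]; exact hint
  have hQ : 1 / η * ∫ x in Ω, (∑ j, b x j ^ 2) * ‖u.val x‖ ^ 2 ≤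
      η / 4 * G + M / η * ‖u.val‖ ^ 2 := by
    calc _ ≤ 1 / η * (η ^ 2 / 4 * G + M * ‖u.val‖ ^ 2) := by
          have := hQle u hu
          gcongr
      _ = _ := by field_simp
  rw [H1.normSq, ← hG]
  linarith

/-! ### The weighted convective field -/

theorem measurable_theta {F : Type*} [NormedAddCommGroup F] [MeasurableSpace F] [BorelSpace F]
    (K : ℝ) : Measurable fun s : F => theta K s := by
  unfold theta
  refine Measurable.ite (measurableSet_singleton 0) measurable_const ?_
  fun_prop

theorem theta_mem_Icc {F : Type*} [NormedAddCommGroup F] {K : ℝ} (hK : 0 < K) (s : F) :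
    theta K s ∈ Icc (0 : ℝ) 1 := by
  unfold theta
  split_ifs with h
  · simp
  · have hs : 0 < ‖s‖ := norm_pos_iff.2 h
    exact ⟨by positivity, (div_le_one hs).2 (min_le_left _ _)⟩

theorem sum_weightedConvection_sq {N : ℕ} (K : ℝ) (c : Space N → Space N) (x : Space N) :
    ∑ j, weightedConvection K c x j ^ 2 = ‖c x - trunc K (c x)‖ ^ 2 := by
  rw [EuclideanSpace.real_norm_sq_eq]
  refine Finset.sum_congr rfl fun j _ => ?_
  rw [weightedConvection, trunc_eq_theta_smul]
  simp; ring

/-! ### Transfer of the Hardy–Lorentz inequality to `H¹₀(Ω)` -/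

/-- Cauchy–Schwarz in coordinates; passing from the operator norm to the gradient norm costs no
constant, so the threshold in (b) is preserved. -/
theorem norm_fderiv_sq_le {N : ℕ} (φ : Space N → ℂ) (x : Space N) :
    ‖fderiv ℝ φ x‖ₑ ^ 2 ≤ ∑ i, ‖partialD i φ x‖ₑ ^ 2 := by
  have h : ‖fderiv ℝ φ x‖ ≤ √(∑ i, ‖partialD i φ x‖ ^ 2) := by
    refine ContinuousLinearMap.opNorm_le_bound _ (Real.sqrt_nonneg _) fun y => ?_
    have hy : fderiv ℝ φ x y = ∑ i, y i • partialD i φ x := by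
      conv_lhs => rw [← (EuclideanSpace.basisFun (Fin N) ℝ).sum_repr y]
      simp [partialD]
    rw [hy]
    calc ‖∑ i, y i • partialD i φ x‖ ≤ ∑ i, ‖partialD i φ x‖ * |y i| := by
          refine (norm_sum_le _ _).trans (le_of_eq (Finset.sum_congr rfl fun i _ => ?_))
          rw [norm_smul, Real.norm_eq_abs, mul_comm]
      _ ≤ √(∑ i, ‖partialD i φ x‖ ^ 2) * √(∑ i, |y i| ^ 2) :=
          Real.sum_mul_le_sqrt_mul_sqrt _ _ _
      _ = _ := by rw [EuclideanSpace.norm_eq]; rfl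
  have h2 : ‖fderiv ℝ φ x‖ ^ 2 ≤ ∑ i, ‖partialD i φ x‖ ^ 2 := by
    rw [← Real.sq_sqrt (Finset.sum_nonneg fun i _ => sq_nonneg ‖partialD i φ x‖)]
    gcongr
  have h3 := ENNReal.ofReal_le_ofReal h2
  rw [ENNReal.ofReal_sum_of_nonneg fun i _ => by positivity] at h3
  simpa only [ENNReal.ofReal_pow (norm_nonneg _), ofReal_norm] using h3

/-- The Hardy–Lorentz inequality for test functions, in terms of the weak norm. -/
theorem lintegral_mul_testFunction_le {N : ℕ} (hN : 3 ≤ N) {Ω : Set (Space N)}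
    (hΩ : MeasurableSet Ω) {d : Space N → Space N}
    (hd : AEStronglyMeasurable d (volume.restrict Ω)) {η : ℝ} (hη : 0 < η)
    (h : weakNorm Ω N d ≤ ENNReal.ofReal η / (2 * sobolevConst N 2)) {φ : Space N → ℂ}
    (hφ : IsTestFunction Ω φ) :
    ∫⁻ x in Ω, ‖d x‖ₑ ^ 2 * ‖φ x‖ₑ ^ 2 ≤
      ENNReal.ofReal (η ^ 2 / 4) * ∑ i, eLpNorm (partialD i φ) 2 (volume.restrict Ω) ^ 2 := by
  have hN3 : (3 : ℝ) ≤ N := by exact_mod_cast hN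
  have hN0 : (0 : ℝ) < N := by linarith
  have hS0 : sobolevConst N 2 ≠ 0 := by
    rw [sobolevConst_two hN]
    refine mul_ne_zero (ENNReal.inv_ne_zero.2
      (ENNReal.rpow_ne_top_of_nonneg (by positivity) measure_ball_lt_top.ne)) ?_
    have : 0 < 2 / ((N : ℝ) - 2) := div_pos two_pos (by linarith)
    simpa using this
  have hSt : sobolevConst N 2 ≠ ∞ := by
    rw [sobolevConst_two hN]
    refine ENNReal.mul_ne_top (ENNReal.inv_ne_top.2 ?_) ENNReal.ofReal_ne_top
    simp [(Metric.measure_ball_pos volume (0 : Space N) one_pos).ne', measure_ball_lt_top.ne]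
  set S := (sobolevConst N 2).toReal with hS
  have hSpos : 0 < S := ENNReal.toReal_pos hS0 hSt
  have hSeq : sobolevConst N 2 = ENNReal.ofReal S := (ENNReal.ofReal_toReal hSt).symm
  -- Using the upper bound instead of the weak norm itself keeps `w` positive and makes `S w = η/2`.
  set w := η / (2 * S) with hw
  have hw0 : 0 < w := by positivity
  have hle : weakNorm Ω N d ≤ ENNReal.ofReal w := by
    refine h.trans (le_of_eq ?_)
    rw [hSeq, hw, ENNReal.ofReal_div_of_pos (by positivity), ENNReal.ofReal_mul two_pos.le]
    simp
  obtain ⟨g, hgm, hg⟩ : ∃ g : Space N → ℝ≥0∞, Measurable g ∧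
      (fun x => ‖d x‖ₑ) =ᵐ[volume.restrict Ω] g := ⟨_, hd.enorm.measurable_mk, hd.enorm.ae_eq_mk⟩
  have hweak : ∀ t : ℝ, 0 < t →
      volume.restrict Ω {x | ENNReal.ofReal t < g x} ≤ ENNReal.ofReal ((w / t) ^ N) := by
    intro t ht
    lift t to ℝ≥0 using ht.le
    have ht' : 0 < t := by exact_mod_cast ht
    have e1 : volume.restrict Ω {x | ENNReal.ofReal t < g x} = distrib Ω d t := by
      have : volume.restrict Ω {x | ENNReal.ofReal t < g x} =
          volume.restrict Ω {x | ENNReal.ofReal t < ‖d x‖ₑ} := by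
        refine measure_congr ?_
        filter_upwards [hg] with x hx
        change (ENNReal.ofReal t < g x) = (ENNReal.ofReal t < ‖d x‖ₑ)
        rw [hx]
      rw [this, Measure.restrict_apply' hΩ, distrib]
      congr 1
      ext x
      simp only [mem_inter_iff, mem_ofPred_eq]
      rw [← ofReal_norm, ENNReal.ofReal_lt_ofReal_iff_of_nonneg ht.le, and_comm]
    rw [weakNorm, one_div, ENNReal.rpow_inv_le_iff hN0] at hle
    have h1 : (t : ℝ≥0∞) ^ (N : ℝ) * distrib Ω d t ≤ ENNReal.ofReal w ^ (N : ℝ) :=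
      le_trans (le_iSup₂ (f := fun (h : ℝ≥0) (_ : 0 < h) =>
        (h : ℝ≥0∞) ^ (N : ℝ) * distrib Ω d h) t ht') hle
    rw [e1, div_pow, ENNReal.ofReal_div_of_pos (by positivity),
      ENNReal.le_div_iff_mul_le (Or.inl (ENNReal.ofReal_pos.2 (pow_pos ht N)).ne') (Or.inl ENNReal.ofReal_ne_top),
      ENNReal.ofReal_pow hw0.le, ENNReal.ofReal_pow ht.le, ENNReal.ofReal_coe_nnreal]
    rwa [ENNReal.rpow_natCast, ENNReal.rpow_natCast, mul_comm] at h1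
  have hHL := hardy_lorentz hN (hφ.smooth.of_le (by exact_mod_cast le_top)) hφ.compact Ω hgm hw0
    hweak
  have hc : (sobolevConst N 2 * ENNReal.ofReal w) ^ 2 = ENNReal.ofReal (η ^ 2 / 4) := by
    rw [hSeq, ← ENNReal.ofReal_mul hSpos.le, ← ENNReal.ofReal_pow (by positivity), hw]
    congr 1; field_simp; norm_num
  rw [hc] at hHL
  have hgrad : ∫⁻ x, ‖fderiv ℝ φ x‖ₑ ^ 2 ≤
      ∑ i, eLpNorm (partialD i φ) 2 (volume.restrict Ω) ^ 2 := by
    have hsub : Function.support (fun x => ‖fderiv ℝ φ x‖ₑ ^ 2) ⊆ Ω := by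
      intro x hx
      refine hφ.supp (support_fderiv_subset ℝ fun h0 => hx ?_)
      change ‖fderiv ℝ φ x‖ₑ ^ 2 = 0
      rw [← ofReal_norm, h0, norm_zero, ENNReal.ofReal_zero, zero_pow two_ne_zero]
    rw [← setLIntegral_eq_of_support_subset hsub]
    simp_rw [eLpNorm_two_sq]
    have hm : ∀ i, Measurable fun x => ‖partialD i φ x‖ₑ ^ 2 := fun i => by
      have : Continuous (partialD i φ) :=
        (hφ.smooth.continuous_fderiv (by simp)).clm_apply continuous_const
      fun_prop
    rw [← lintegral_finsetSum _ fun i _ => hm i]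
    exact lintegral_mono fun x => norm_fderiv_sq_le φ x
  have hcongr : ∫⁻ x in Ω, ‖d x‖ₑ ^ 2 * ‖φ x‖ₑ ^ 2 = ∫⁻ x in Ω, g x ^ 2 * ‖φ x‖ₑ ^ 2 := by
    refine lintegral_congr_ae ?_
    filter_upwards [hg] with x hx
    rw [← hx]
  rw [hcongr]
  exact hHL.trans (mul_le_mul' le_rfl hgrad)

/-- The Hardy–Lorentz inequality on `H¹₀(Ω)`. -/
theorem lintegral_mul_H10_le {N : ℕ} (hN : 3 ≤ N) {Ω : Set (Space N)}
    (hΩ : MeasurableSet Ω) {d : Space N → Space N}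
    (hd : AEStronglyMeasurable d (volume.restrict Ω)) {η : ℝ} (hη : 0 < η)
    (h : weakNorm Ω N d ≤ ENNReal.ofReal η / (2 * sobolevConst N 2)) {u : H1 Ω} (hu : u ∈ H10 Ω) :
    ∫⁻ x in Ω, ‖d x‖ₑ ^ 2 * ‖u.val x‖ₑ ^ 2 ≤
      ENNReal.ofReal (η ^ 2 / 4) * ∑ i, eLpNorm (u.grad i) 2 (volume.restrict Ω) ^ 2 := by
  obtain ⟨φ, hφ, hval, hgrad⟩ := hu
  -- An a.e. convergent subsequence and Fatou handle the left side, so finiteness of `∫ |d|²|u|²`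
  -- need not be known beforehand.
  have hmeas : TendstoInMeasure (volume.restrict Ω) φ atTop u.val :=
    tendstoInMeasure_of_tendsto_eLpNorm two_ne_zero
      (fun n => (hφ n).smooth.continuous.aestronglyMeasurable) (Lp.aestronglyMeasurable _) hval
  obtain ⟨ns, hns, hae⟩ := hmeas.exists_seq_tendsto_ae
  set E : ℕ → ℝ≥0∞ := fun n => ENNReal.ofReal (η ^ 2 / 4) * ∑ i,
    (eLpNorm (fun x => partialD i (φ (ns n)) x - u.grad i x) 2 (volume.restrict Ω)
      + eLpNorm (u.grad i) 2 (volume.restrict Ω)) ^ 2 with hE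
  have hElim : Tendsto E atTop (𝓝 (ENNReal.ofReal (η ^ 2 / 4) *
      ∑ i, eLpNorm (u.grad i) 2 (volume.restrict Ω) ^ 2)) := by
    refine ENNReal.Tendsto.const_mul (tendsto_finsetSum _ fun i _ => ?_)
      (Or.inr ENNReal.ofReal_ne_top)
    refine ENNReal.Tendsto.pow ?_
    have := ((hgrad i).comp hns.tendsto_atTop).add_const
      (eLpNorm (u.grad i) 2 (volume.restrict Ω))
    simpa only [zero_add, Function.comp_def] using this
  have hle : ∀ n, ∫⁻ x in Ω, ‖d x‖ₑ ^ 2 * ‖φ (ns n) x‖ₑ ^ 2 ≤ E n := by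
    intro n
    refine (lintegral_mul_testFunction_le hN hΩ hd hη h (hφ (ns n))).trans ?_
    refine mul_le_mul' le_rfl (Finset.sum_le_sum fun i _ => pow_le_pow_left' ?_ 2)
    have hcont : Continuous (partialD i (φ (ns n))) :=
      ((hφ (ns n)).smooth.continuous_fderiv (by simp)).clm_apply continuous_const
    have := eLpNorm_add_le (μ := volume.restrict Ω) (p := 2)
      (f := fun x => partialD i (φ (ns n)) x - u.grad i x) (g := u.grad i)
      (hcont.aestronglyMeasurable.sub (Lp.aestronglyMeasurable _)) (Lp.aestronglyMeasurable _)
      one_le_two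
    refine le_trans (le_of_eq ?_) this
    congr 1
    ext x; simp
  calc ∫⁻ x in Ω, ‖d x‖ₑ ^ 2 * ‖u.val x‖ₑ ^ 2
      = ∫⁻ x in Ω, liminf (fun n => ‖d x‖ₑ ^ 2 * ‖φ (ns n) x‖ₑ ^ 2) atTop := by
        refine lintegral_congr_ae ?_
        filter_upwards [hae] with x hx
        have h1 : Tendsto (fun n => ‖φ (ns n) x‖ₑ ^ 2) atTop (𝓝 (‖u.val x‖ₑ ^ 2)) :=
          ENNReal.Tendsto.pow hx.enorm
        exact (ENNReal.Tendsto.const_mul h1 (Or.inr (by finiteness))).liminf_eq.symm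
    _ ≤ liminf (fun n => ∫⁻ x in Ω, ‖d x‖ₑ ^ 2 * ‖φ (ns n) x‖ₑ ^ 2) atTop :=
        lintegral_liminf_le' fun n => (hd.enorm.pow_const 2).mul
          ((hφ (ns n)).smooth.continuous.aestronglyMeasurable.enorm.pow_const 2)
    _ ≤ liminf E atTop := liminf_le_liminf (Eventually.of_forall hle)
    _ = _ := hElim.liminf_eq

/-! ### The borderline dimension `N = 2` -/

theorem ae_eq_zero_of_weakNorm_eq_zero {N : ℕ} {Ω : Set (Space N)} (hΩ : MeasurableSet Ω) {p : ℝ}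
    (hp : 0 < p) {d : Space N → Space N} (h : weakNorm Ω p d = 0) :
    ∀ᵐ x ∂(volume.restrict Ω), d x = 0 := by
  rw [weakNorm, ENNReal.rpow_eq_zero_iff_of_pos (by positivity)] at h
  simp only [ENNReal.iSup_eq_zero, mul_eq_zero] at h
  have hdist : ∀ n : ℕ, volume.restrict Ω {x | 1 / ((n : ℝ) + 1) < ‖d x‖} = 0 := by
    intro n
    have hn : 0 < 1 / ((n : ℝ≥0) + 1) := by positivity
    rcases h _ hn with h0 | h0
    · rw [ENNReal.rpow_eq_zero_iff_of_pos hp] at h0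
      exact absurd h0 (by exact_mod_cast hn.ne')
    · rw [Measure.restrict_apply' hΩ, inter_comm]
      have he : Ω ∩ {x | 1 / ((n : ℝ) + 1) < ‖d x‖} =
          {x ∈ Ω | ((1 / ((n : ℝ≥0) + 1) : ℝ≥0) : ℝ) < ‖d x‖} := by
        ext x; simp
      rw [he]
      exact h0
  have : {x | ¬ d x = 0} = ⋃ n : ℕ, {x | 1 / ((n : ℝ) + 1) < ‖d x‖} := by
    ext x
    simp only [mem_ofPred_eq, mem_iUnion]
    constructor
    · intro hx; exact exists_nat_one_div_lt (norm_pos_iff.2 hx)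
    · rintro ⟨n, hn⟩ h0
      rw [h0, norm_zero] at hn
      exact absurd hn (not_lt.2 (by positivity))
  rw [ae_iff, this, measure_iUnion_null_iff]
  exact hdist

/-- In `[0, ∞]` one has `2 / (2 - 2) = ∞` and `η / ∞ = 0`, so for `N = 2` the smallness condition
forces `c = T_K c` a.e. -/
theorem ofReal_div_sobolevConst_two (η : ℝ) :
    ENNReal.ofReal η / (2 * sobolevConst 2 2) = 0 := by
  have hω : volume (Metric.ball (0 : Space 2) 1) ^ (-(1 / ((2 : ℕ) : ℝ))) ≠ 0 := by
    rw [ENNReal.rpow_neg]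
    exact ENNReal.inv_ne_zero.2
      (ENNReal.rpow_ne_top_of_nonneg (by positivity) measure_ball_lt_top.ne)
  have : sobolevConst 2 2 = ∞ := by
    rw [sobolevConst]
    simp only [Nat.cast_ofNat, tsub_self]
    rw [ENNReal.div_zero two_ne_zero, ENNReal.mul_top]
    exact hω
  rw [this, ENNReal.mul_top two_ne_zero, ENNReal.div_eq_zero_iff]
  exact Or.inr rfl

end ConvDiff

/-! ### The two assertions -/

theorem lemma3p1 (N : ℕ) (hN : 2 ≤ N)
    (Ω : Set (ConvDiff.Space N)) (hΩ : IsOpen Ω) (hΩb : Bornology.IsBounded Ω)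
    (D : ConvDiff.Coeffs N) (η : ℝ) (hD : D.IsStronglyElliptic Ω η)
    (c : ConvDiff.Space N → ConvDiff.Space N) (hc : ConvDiff.MemWeakLp Ω N c)
    (K : ℝ) (hK : 0 < K) :
    (ConvDiff.IsWellDefinedOn D (ConvDiff.weightField K c) (Set.univ : Set (ConvDiff.H1 Ω)) ∧
      ConvDiff.IsL2Elliptic (Set.univ : Set (ConvDiff.H1 Ω))
        (ConvDiff.form D (ConvDiff.weightField K c))) ∧
    (ConvDiff.weakNorm Ω N (fun x => c x - ConvDiff.trunc K (c x))
        ≤ ENNReal.ofReal η / (2 * ConvDiff.sobolevConst N 2) →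
      ConvDiff.IsWellDefinedOn D (ConvDiff.weightedConvection K c) (ConvDiff.H10 Ω) ∧
      ConvDiff.IsL2Elliptic (ConvDiff.H10 Ω)
        (ConvDiff.form D (ConvDiff.weightedConvection K c))) := by
  open ConvDiff in
  have hΩm := hΩ.measurableSet
  have hη := hD.pos
  have hθ : AEStronglyMeasurable (fun x => theta K (c x)) (volume.restrict Ω) :=
    ((measurable_theta K).comp_aemeasurable hc.1.aemeasurable).aestronglyMeasurable
  constructor
  -- Each of the `N` components `1 - θ` lies in `[0, 1]`, so `|b|² ≤ N` and no gradient term is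
  -- needed.
  · refine wellDefined_and_elliptic_of_bound (M := N) hΩm hD (fun j => ?_) (by positivity)
      fun u _ => ?_
    · exact aestronglyMeasurable_const.sub hθ
    · have hle : ∀ x, (∑ j, weightField K c x j ^ 2) * ‖u.val x‖ ^ 2 ≤ N * ‖u.val x‖ ^ 2 := by
        intro x
        have h01 := theta_mem_Icc hK (c x)
        have : (1 - theta K (c x)) ^ 2 ≤ 1 := by nlinarith [h01.1, h01.2]
        have hs : ∑ j, weightField K c x j ^ 2 ≤ N := by
          simp only [weightField, Finset.sum_const, Finset.card_univ, Fintype.card_fin,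
            nsmul_eq_mul]
          nlinarith [(Nat.cast_nonneg N : (0 : ℝ) ≤ N)]
        gcongr
      refine (lintegral_mono fun x => ENNReal.ofReal_le_ofReal (hle x)).trans ?_
      rw [← ofReal_integral_eq_lintegral_ofReal ((integrable_norm_sq_Lp u.val).const_mul _)
        (Filter.Eventually.of_forall fun x => by positivity), integral_const_mul,
        integral_norm_sq_Lp]
      refine ENNReal.ofReal_le_ofReal (le_add_of_nonneg_left ?_)
      positivity
  · intro hw
    have hd : AEStronglyMeasurable (fun x => c x - trunc K (c x)) (volume.restrict Ω) := by
      simp_rw [trunc_eq_theta_smul]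
      exact hc.1.sub (hθ.smul hc.1)
    -- The Hardy–Lorentz bound has no zero-order remainder, hence `M = 0`.
    refine wellDefined_and_elliptic_of_bound (M := 0) hΩm hD (fun j => ?_) le_rfl
      fun u hu => ?_
    · have hcj : AEStronglyMeasurable (fun x => c x j) (volume.restrict Ω) :=
        (EuclideanSpace.proj (𝕜 := ℝ) j).continuous.comp_aestronglyMeasurable hc.1
      exact (aestronglyMeasurable_const.sub hθ).mul hcj
    · have hrw : ∀ x, ENNReal.ofReal ((∑ j, weightedConvection K c x j ^ 2) * ‖u.val x‖ ^ 2) =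
          ‖c x - trunc K (c x)‖ₑ ^ 2 * ‖u.val x‖ₑ ^ 2 := by
        intro x
        rw [sum_weightedConvection_sq, ENNReal.ofReal_mul (by positivity),
          ENNReal.ofReal_pow (norm_nonneg _), ENNReal.ofReal_pow (norm_nonneg _), ofReal_norm,
          ofReal_norm]
      simp_rw [hrw]
      rcases hN.eq_or_lt with rfl | hN3
      · rw [ofReal_div_sobolevConst_two, nonpos_iff_eq_zero] at hw
        have h0 := ae_eq_zero_of_weakNorm_eq_zero hΩm (by positivity) hw
        rw [lintegral_congr_ae (g := fun _ => 0)]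
        · simp
        · filter_upwards [h0] with x hx
          simp [hx]
      · refine (lintegral_mul_H10_le hN3 hΩm hd hη hw hu).trans (le_of_eq ?_)
        rw [zero_mul, add_zero, ENNReal.ofReal_mul (by positivity),
          ENNReal.ofReal_sum_of_nonneg fun i _ => by positivity]
        congr 1
        refine Finset.sum_congr rfl fun i _ => ?_
        rw [ENNReal.ofReal_pow (norm_nonneg _), Lp.norm_def,
          ENNReal.ofReal_toReal (Lp.eLpNorm_ne_top _)]
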